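/- Conventions. All topological groups are locally compact, second countable and Hausdorff (lcsc), all Banach spaces are real, and $1<p<\infty$. An $L^p$-space is a Banach space isometrically isomorphic to $L^p(Z,\mu)$ for some $\sigma$-finite measure $\mu$ on a standard Borel space $Z$. $O(E)$ is the group of surjective linear isometries of $E$, with the Borel structure of the strong operator topology. A wq-$L^p$-pair $(\pi,b)$ for an lcsc group $G$ with underlying $L^p$-space $E$ consists of Borel maps $\pi:G\to O(E)$ (not necessarily a homomorphism) and $b:G\to E$ with $\sup_{g_1,g_2\in G}\|b(g_1g_2)-b(g_1)-\pi(g_1)b(g_2)\|<\infty$. It is a quasi-$L^p$-pair if moreover $\pi$ is a homomorphism. It is an affine $L^p$-action if $\pi$ is a strongly continuous homomorphism, $b$ is continuous, and $b(g_1g_2)=b(g_1)+\pi(g_1)b(g_2)$ for all $g_1,g_2$. For $A\subset G$, the group $G$ has (F$L^p$), (FF$L^p$) or (FFF$L^p$) relative to $A$ if $b$ is bounded on $A$ for every affine $L^p$-action, quasi-$L^p$-pair or wq-$L^p$-pair $(\pi,b)$ for $G$, respectively; for $A=G$ one says that $G$ has the property. These three are the $L^p$-Kazhdan-type properties. For a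 subset $\Lambda$ of a group, let $\Lambda^\infty$ be the group generated by $\Lambda$, with the discrete topology; $(\Lambda,\Lambda^\infty)$ has such a property if $\Lambda^\infty$ has it relative to $\Lambda$. A uniform cut-and-project scheme $(G,H,\Gamma)$ consists of lcsc groups $G,H$ and a uniform (cocompact) lattice $\Gamma<G\times H$ that projects injectively to $G$ and densely to $H$. Put $Y=(G\times H)/\Gamma$, let $m$ be the $G\times H$-invariant Borel probability measure on $Y$, and let $s:Y\to G\times H$ be a Borel section with precompact image. Put $\beta(g,x)=s(gx)^{-1}g\,s(x)\in\Gamma$. The pair induced from a wq-$L^p$-pair $(\pi,b)$ for the discrete group $\Gamma$ with underlying space $E$ is the pair $(\widehat\pi,\widehat b)$ of maps on $G\times H$, with underlying space $L^p(Y,m;E)$, given by $$(\widehat\pi(g)f)(x)=\pi(\beta(g^{-1},x)^{-1})f(g^{-1}x),\qquad \widehat b(g)(x)=b(\beta(g^{-1},x)^{-1}).$$ Theorem. Let $(G,H,\Gamma)$ be a uniform cut-and-project scheme, $W\subset H$ a compact subset (the window), $1<p<\infty$, and $\Gamma_W=\Gamma\cap(G\times W)$. (1) Let $(\pi,b)$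 be a wq-$L^p$-pair for $\Gamma$, and let $(\widehat\pi,\widehat b)$ be the pair induced to $G\times H$ by means of any bounded Borel section $s$ as above. If $\widehat b$ is bounded on $G\times\{e\}$, then $b$ is bounded on $\Gamma_W$. (2) Suppose moreover that $W$ has non-empty interior and that the model set $\Lambda=\pi_G(\Gamma\cap(G\times W))\subset G$, where $\pi_G:G\times H\to G$ is the coordinate projection, is symmetric ($\Lambda=\Lambda^{-1}$) and contains the identity. If $G$ has one of the three $L^p$-Kazhdan-type properties, then $(\Lambda,\Lambda^\infty)$ has the same property. -/

import Mathlib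

open MeasureTheory Set
open scoped ENNReal

/-! ### Lattices and cut-and-project schemes -/

/-- A lattice in a lcsc group `K`: a discrete subgroup `Γ` such that the homogeneous space `K ⧸ Γ`
carries a `K`-invariant Borel probability measure. The σ-algebra of `K ⧸ Γ` is the quotient
σ-algebra; it is the Borel σ-algebra, see `borelSpace_coset` below. -/
structure IsLattice {K : Type*} [Group K] [TopologicalSpace K] [MeasurableSpace K]
    (Γ : Subgroup K) : Prop where
  discrete : DiscreteTopology Γ
  exists_measure : ∃ m : Measure (K ⧸ Γ), IsProbabilityMeasure m ∧ SMulInvariantMeasure K (K ⧸ Γ) m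

/-- A uniform (i.e. cocompact) lattice. -/
structure IsUniformLattice {K : Type*} [Group K] [TopologicalSpace K] [MeasurableSpace K]
    (Γ : Subgroup K) : Prop extends IsLattice Γ where
  compact : CompactSpace (K ⧸ Γ)

/-- `(G, H, Γ)` is a uniform cut-and-project scheme: `Γ` is a uniform lattice in `G × H` which
projects injectively to `G` and densely to `H`. -/
structure IsUniformCutAndProjectScheme {G H : Type*} [Group G] [TopologicalSpace G]
    [MeasurableSpace G] [Group H] [TopologicalSpace H] [MeasurableSpace H]
    (Γ : Subgroup (G × H)) : Prop extends IsUniformLattice Γ where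
  injOn_fst : InjOn Prod.fst (Γ : Set (G × H))
  dense_snd : Dense (Prod.snd '' (Γ : Set (G × H)))

/-- The subset `Γ_W = Γ ∩ (G × W)` of `Γ`. -/
def windowSet {G H : Type*} [Group G] [Group H] (Γ : Subgroup (G × H)) (W : Set H) : Set Γ :=
  {γ | (γ : G × H).2 ∈ W}

/-- The (weak) model set `Λ(G, H, Γ, W)`, the projection of `Γ ∩ (G × W)` to `G`. -/
def modelSet {G H : Type*} [Group G] [Group H] (Γ : Subgroup (G × H)) (W : Set H) : Set G :=
  Prod.fst '' ((Γ : Set (G × H)) ∩ univ ×ˢ W)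

/-! ### Cocycles and their weakenings, with values in `L^p`-spaces -/

/-- `E` is an `L^p`-space: it is isometrically isomorphic to the real space `L^p(Z, μ)` for some
σ-finite measure `μ` on a standard Borel space `Z`. (Every standard Borel space is Borel isomorphic
to one in `Type`, so there is no loss in taking `Z : Type`.) -/
def IsLpSpace (p : ℝ≥0∞) [Fact (1 ≤ p)] (E : Type*) [NormedAddCommGroup E] [NormedSpace ℝ E] :
    Prop :=
  ∃ (Z : Type) (_ : MeasurableSpace Z) (_ : StandardBorelSpace Z) (μ : Measure Z)
    (_ : SigmaFinite μ), Nonempty (E ≃ₗᵢ[ℝ] Lp ℝ p μ)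

/-- The strong operator topology (topology of pointwise convergence) on the group `O(E)` of
surjective linear isometries of `E`. -/
abbrev strongOperatorTopology (E : Type*) [NormedAddCommGroup E] [NormedSpace ℝ E] :
    TopologicalSpace (E ≃ₗᵢ[ℝ] E) :=
  TopologicalSpace.induced (fun T v => T v) (inferInstance : TopologicalSpace (E → E))

/-- `(π, b)` is a wq-`L^p`-pair for the topological group `G`: the underlying space `E` is an
`L^p`-space, `π : G → O(E)` and `b : G → E` are Borel maps (`π` need not be a homomorphism), and
the defect `‖b (g₁ g₂) - b g₁ - π g₁ (b g₂)‖` is bounded. -/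
structure IsWQPair (p : ℝ≥0∞) [Fact (1 ≤ p)] {G : Type*} [Group G] [TopologicalSpace G]
    {E : Type*} [NormedAddCommGroup E] [NormedSpace ℝ E]
    (π : G → (E ≃ₗᵢ[ℝ] E)) (b : G → E) : Prop where
  isLpSpace : IsLpSpace p E
  measurable_rep : @Measurable _ _ (borel G) (@borel _ (strongOperatorTopology E)) π
  measurable_cocycle : @Measurable _ _ (borel G) (borel E) b
  bounded_defect : ∃ D : ℝ, ∀ g₁ g₂ : G, ‖b (g₁ * g₂) - b g₁ - π g₁ (b g₂)‖ ≤ D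

/-- `(π, b)` is a quasi-`L^p`-pair: a wq-`L^p`-pair whose `π` is a homomorphism. -/
structure IsQuasiPair (p : ℝ≥0∞) [Fact (1 ≤ p)] {G : Type*} [Group G] [TopologicalSpace G]
    {E : Type*} [NormedAddCommGroup E] [NormedSpace ℝ E]
    (π : G → (E ≃ₗᵢ[ℝ] E)) (b : G → E) : Prop extends IsWQPair p π b where
  map_mul : ∀ g₁ g₂ : G, π (g₁ * g₂) = π g₁ * π g₂

/-- `(π, b)` is an affine `L^p`-action: `π` is a continuous orthogonal representation on an
`L^p`-space, and `b` is a continuous cocycle with respect to `π`. -/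
structure IsAffineAction (p : ℝ≥0∞) [Fact (1 ≤ p)] {G : Type*} [Group G] [TopologicalSpace G]
    {E : Type*} [NormedAddCommGroup E] [NormedSpace ℝ E]
    (π : G → (E ≃ₗᵢ[ℝ] E)) (b : G → E) : Prop where
  isLpSpace : IsLpSpace p E
  map_mul : ∀ g₁ g₂ : G, π (g₁ * g₂) = π g₁ * π g₂
  continuous_rep : ∀ v : E, Continuous fun g => π g v
  cocycle : ∀ g₁ g₂ : G, b (g₁ * g₂) = b g₁ + π g₁ (b g₂)
  continuous_cocycle : Continuous b

/-- `b` is bounded on the set `A`. -/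
def IsBoundedOn {X E : Type*} [NormedAddCommGroup E] (b : X → E) (A : Set X) : Prop :=
  ∃ C : ℝ, ∀ x ∈ A, ‖b x‖ ≤ C

/-! ### Kazhdan-type properties -/

/-- The three `L^p`-Kazhdan-type properties (F`L^p`), (FF`L^p`) and (FFF`L^p`). -/
inductive KazhdanType
  | F
  | FF
  | FFF

/-- The pairs `(π, b)` which the given Kazhdan-type property is about. -/
def KazhdanType.IsPair (T : KazhdanType) (p : ℝ≥0∞) [Fact (1 ≤ p)] {G : Type*} [Group G]
    [TopologicalSpace G] {E : Type*} [NormedAddCommGroup E] [NormedSpace ℝ E]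
    (π : G → (E ≃ₗᵢ[ℝ] E)) (b : G → E) : Prop :=
  match T with
  | .F => IsAffineAction p π b
  | .FF => IsQuasiPair p π b
  | .FFF => IsWQPair p π b

/-- The topological group `G` has the `L^p`-Kazhdan-type property `T` relative to the subset `A`:
every cocycle (resp. quasi-cocycle, resp. weak quasi-cocycle) on `G` with values in an `L^p`-space
is bounded on `A`. (Every `L^p`-space is isometrically isomorphic to one in `Type`.) -/
def KazhdanType.HasRel (T : KazhdanType) (p : ℝ≥0∞) [Fact (1 ≤ p)] (G : Type*) [Group G]
    [TopologicalSpace G] (A : Set G) : Prop :=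
  ∀ (E : Type) [NormedAddCommGroup E] [NormedSpace ℝ E] (π : G → (E ≃ₗᵢ[ℝ] E)) (b : G → E),
    T.IsPair p π b → IsBoundedOn b A

/-- The topological group `G` has the `L^p`-Kazhdan-type property `T`. -/
def KazhdanType.Has (T : KazhdanType) (p : ℝ≥0∞) [Fact (1 ≤ p)] (G : Type*) [Group G]
    [TopologicalSpace G] : Prop :=
  T.HasRel p G univ

/-- The approximate group `(Λ, Λ^∞)`, where `Λ^∞` is the subgroup generated by `Λ`, has the
`L^p`-Kazhdan-type property `T`: the group `Λ^∞`, with the discrete topology, has `T` relative to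
`Λ`. -/
def KazhdanType.HasApprox (T : KazhdanType) (p : ℝ≥0∞) [Fact (1 ≤ p)] {G : Type*} [Group G]
    (Λ : Set G) : Prop :=
  @KazhdanType.HasRel T p _ (Subgroup.closure Λ) _ ⊥ (Subtype.val ⁻¹' Λ)

/-! ### Induction from a discrete subgroup -/

/-- The quotient σ-algebra of `K ⧸ Γ` is its Borel σ-algebra. -/
theorem borelSpace_coset {K : Type*} [Group K] [TopologicalSpace K] [IsTopologicalGroup K]
    [T2Space K] [SecondCountableTopology K] [MeasurableSpace K] [BorelSpace K]
    [LocallyCompactSpace K] (Γ : Subgroup K) (hΓ : DiscreteTopology Γ) :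
    BorelSpace (K ⧸ Γ) := by
  have : PolishSpace K := by
    let _ : UniformSpace K := IsTopologicalGroup.rightUniformSpace K
    have : IsRightUniformGroup K := { uniformity_eq := rfl }
    have : CompleteSpace K := IsRightUniformGroup.completeSpace_of_weaklyLocallyCompactSpace
    have : (uniformity K).IsCountablyGenerated := Filter.comap.isCountablyGenerated _ _
    infer_instance
  have : IsClosed (Γ : Set K) := Subgroup.isClosed_of_discrete
  infer_instance

theorem measurable_smul_coset {K : Type*} [Group K] [TopologicalSpace K] [IsTopologicalGroup K]
    [MeasurableSpace K] [BorelSpace K]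
    (Γ : Subgroup K) (g : K) : Measurable fun x : K ⧸ Γ => g • x := by
  rw [QuotientGroup.measurable_from_quotient]
  exact QuotientGroup.measurable_coe.comp (measurable_const_mul g)

theorem measurePreserving_smul_coset {K : Type*} [Group K] [TopologicalSpace K] [IsTopologicalGroup K]
    [MeasurableSpace K] [BorelSpace K]
    {Γ : Subgroup K} (m : Measure (K ⧸ Γ)) [SMulInvariantMeasure K (K ⧸ Γ) m] (g : K) :
    MeasurePreserving (fun x : K ⧸ Γ => g • x) m m where
  measurable := measurable_smul_coset Γ g
  map_eq := by
    ext A hA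
    rw [Measure.map_apply (measurable_smul_coset Γ g) hA]
    exact SMulInvariantMeasure.measure_preimage_smul g hA

/-- A bounded Borel section of the projection `K → K ⧸ Γ`: its image is precompact. -/
structure BoundedBorelSection {K : Type*} [Group K] [TopologicalSpace K] [MeasurableSpace K]
    (Γ : Subgroup K) where
  toFun : K ⧸ Γ → K
  measurable_toFun : Measurable toFun
  mk_toFun : ∀ x, (toFun x : K ⧸ Γ) = x
  bounded : IsCompact (closure (range toFun))

/-- The cocycle `β(g, x) = s(g x)⁻¹ g s(x)` associated with the section `s`. -/
def BoundedBorelSection.beta {K : Type*} [Group K] [TopologicalSpace K] [MeasurableSpace K]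
    {Γ : Subgroup K} (s : BoundedBorelSection Γ) (g : K) (x : K ⧸ Γ) : Γ :=
  ⟨(s.toFun (g • x))⁻¹ * (g * s.toFun x), by
    rw [← QuotientGroup.eq, s.mk_toFun]
    conv_lhs => rw [← s.mk_toFun x]
    rfl⟩

theorem measurable_beta_inv {K : Type*} [Group K] [TopologicalSpace K] [IsTopologicalGroup K]
    [T2Space K] [SecondCountableTopology K] [MeasurableSpace K] [BorelSpace K]
    {Γ : Subgroup K} (s : BoundedBorelSection Γ) (g : K) :
    Measurable fun x => (s.beta g x)⁻¹ := by
  have h : Measurable fun x => ((s.toFun (g • x))⁻¹ * (g * s.toFun x))⁻¹ :=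
    (((s.measurable_toFun.comp (measurable_smul_coset Γ g)).inv).mul
      (s.measurable_toFun.const_mul g)).inv
  exact h.subtype_mk

theorem finite_range_beta_inv {K : Type*} [Group K] [TopologicalSpace K] [IsTopologicalGroup K]
    [T2Space K] [SecondCountableTopology K] [MeasurableSpace K] [BorelSpace K]
    {Γ : Subgroup K} (hΓ : DiscreteTopology Γ) (s : BoundedBorelSection Γ) (g : K) :
    (range fun x => (s.beta g x)⁻¹).Finite := by
  have hQ : IsCompact ((fun q : K × K => (q.1⁻¹ * (g * q.2))⁻¹) ''
      (closure (range s.toFun) ×ˢ closure (range s.toFun))) :=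
    (s.bounded.prod s.bounded).image (f := fun q : K × K => (q.1⁻¹ * (g * q.2))⁻¹) (by fun_prop)
  have hfin := (Subgroup.tendsto_coe_cofinite_of_discrete Γ
    (isDiscrete_iff_discreteTopology.2 hΓ)) hQ.compl_mem_cocompact
  refine Set.Finite.subset (s := Subtype.val ⁻¹' _) (by simpa using hfin) ?_
  rintro _ ⟨x, rfl⟩
  refine ⟨(s.toFun (g • x), s.toFun x), ⟨subset_closure ⟨_, rfl⟩, subset_closure ⟨_, rfl⟩⟩, ?_⟩
  simp [BoundedBorelSection.beta]

theorem memLp_inducedCocycle {K : Type*} [Group K] [TopologicalSpace K] [IsTopologicalGroup K]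
    [T2Space K] [SecondCountableTopology K] [MeasurableSpace K] [BorelSpace K]
    {Γ : Subgroup K} (hΓ : DiscreteTopology Γ) (s : BoundedBorelSection Γ) (m : Measure (K ⧸ Γ))
    [IsFiniteMeasure m] (p : ℝ≥0∞) {E : Type*} [NormedAddCommGroup E] (b : Γ → E) (g : K) :
    MemLp (fun x => b (s.beta g⁻¹ x)⁻¹) p m := by
  have : Countable Γ := countable_of_Lindelof_of_discrete
  have hfin : (range fun x => ‖b (s.beta g⁻¹ x)⁻¹‖).Finite := by
    have := (finite_range_beta_inv hΓ s g⁻¹).image fun γ => ‖b γ‖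
    rwa [← range_comp] at this
  obtain ⟨C, hC⟩ := hfin.bddAbove
  refine MemLp.of_bound ?_ C (Filter.Eventually.of_forall fun x => hC ⟨x, rfl⟩)
  exact ((StronglyMeasurable.of_discrete (f := b)).comp_measurable
    (measurable_beta_inv s g⁻¹)).aestronglyMeasurable

theorem memLp_fiberwise {Y ι E : Type*} [MeasurableSpace Y] {m : Measure Y} [Countable ι]
    [MeasurableSpace ι] [MeasurableSingletonClass ι] [NormedAddCommGroup E] [NormedSpace ℝ E]
    {p : ℝ≥0∞} {i : Y → ι} (hi : Measurable i) (T : ι → (E ≃ₗᵢ[ℝ] E)) (f : Lp E p m) :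
    MemLp (fun x => T (i x) (f x)) p m := by
  refine (memLp_congr_norm ?_ (Lp.memLp f).1 (by simp)).2 (Lp.memLp f)
  have hU : ⋃ j, i ⁻¹' {j} = univ := by ext; simp
  suffices h : AEStronglyMeasurable (fun x => T (i x) (f x)) (m.restrict (⋃ j, i ⁻¹' {j})) by
    rwa [hU, Measure.restrict_univ] at h
  rw [aestronglyMeasurable_iUnion_iff]
  intro j
  refine ((T j).continuous.comp_aestronglyMeasurable (Lp.memLp f).1.restrict).congr ?_
  refine (ae_restrict_iff' (hi (measurableSet_singleton j))).2 (Filter.Eventually.of_forall ?_)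
  rintro x rfl
  rfl

/-- The isometry `f ↦ (x ↦ T (i x) (f x))` of `L^p(Y; E)`. -/
noncomputable def fiberwiseIsometry {Y ι E : Type*} [MeasurableSpace Y] (m : Measure Y)
    [Countable ι] [MeasurableSpace ι] [MeasurableSingletonClass ι] [NormedAddCommGroup E]
    [NormedSpace ℝ E] (p : ℝ≥0∞) [Fact (1 ≤ p)] {i : Y → ι} (hi : Measurable i)
    (T : ι → (E ≃ₗᵢ[ℝ] E)) : Lp E p m ≃ₗᵢ[ℝ] Lp E p m where
  toFun f := (memLp_fiberwise hi T f).toLp _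
  invFun f := (memLp_fiberwise hi (fun j => (T j).symm) f).toLp _
  map_add' f f' := by
    ext1
    filter_upwards [(memLp_fiberwise hi T f).coeFn_toLp, (memLp_fiberwise hi T f').coeFn_toLp,
      (memLp_fiberwise hi T (f + f')).coeFn_toLp, Lp.coeFn_add f f',
      Lp.coeFn_add ((memLp_fiberwise hi T f).toLp _) ((memLp_fiberwise hi T f').toLp _)]
      with x h₁ h₂ h₃ h₄ h₅
    rw [h₃, h₅, Pi.add_apply, h₁, h₂, h₄, Pi.add_apply, map_add]
  map_smul' c f := by
    ext1
    filter_upwards [(memLp_fiberwise hi T f).coeFn_toLp,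
      (memLp_fiberwise hi T (c • f)).coeFn_toLp, Lp.coeFn_smul c f,
      Lp.coeFn_smul c ((memLp_fiberwise hi T f).toLp _)] with x h₁ h₂ h₃ h₄
    rw [RingHom.id_apply, h₂, h₄, Pi.smul_apply, h₁, h₃, Pi.smul_apply, map_smul]
  left_inv f := by
    ext1
    filter_upwards [(memLp_fiberwise hi T f).coeFn_toLp, (memLp_fiberwise hi
      (fun j => (T j).symm) ((memLp_fiberwise hi T f).toLp _)).coeFn_toLp] with x h₁ h₂
    rw [h₂, h₁, LinearIsometryEquiv.symm_apply_apply]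
  right_inv f := by
    ext1
    filter_upwards [(memLp_fiberwise hi (fun j => (T j).symm) f).coeFn_toLp, (memLp_fiberwise hi
      T ((memLp_fiberwise hi (fun j => (T j).symm) f).toLp _)).coeFn_toLp] with x h₁ h₂
    rw [h₂, h₁, LinearIsometryEquiv.apply_symm_apply]
  norm_map' f := by
    simp only [LinearEquiv.coe_mk, LinearMap.coe_mk, AddHom.coe_mk]
    rw [Lp.norm_toLp, Lp.norm_def]
    exact congrArg _ (eLpNorm_congr_norm_ae (Filter.Eventually.of_forall (by simp)))

/-- The isometry `f ↦ (x ↦ f (g⁻¹ x))` of `L^p(K ⧸ Γ; E)`. -/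
noncomputable def translationIsometry {K : Type*} [Group K] [TopologicalSpace K] [IsTopologicalGroup K]
    [MeasurableSpace K] [BorelSpace K]
    {Γ : Subgroup K} (m : Measure (K ⧸ Γ)) [SMulInvariantMeasure K (K ⧸ Γ) m]
    (p : ℝ≥0∞) [Fact (1 ≤ p)] (E : Type*) [NormedAddCommGroup E] [NormedSpace ℝ E] (g : K) :
    Lp E p m ≃ₗᵢ[ℝ] Lp E p m :=
  LinearIsometryEquiv.ofSurjective
    (Lp.compMeasurePreservingₗᵢ ℝ _ (measurePreserving_smul_coset m g⁻¹)) fun f => by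
      refine ⟨Lp.compMeasurePreserving _ (measurePreserving_smul_coset m g) f, ?_⟩
      ext1
      refine (Lp.coeFn_compMeasurePreserving _ (measurePreserving_smul_coset m g⁻¹)).trans ?_
      filter_upwards [(measurePreserving_smul_coset m g⁻¹).quasiMeasurePreserving.ae
        (Lp.coeFn_compMeasurePreserving f (measurePreserving_smul_coset m g))] with x hx
      rw [Function.comp_apply, hx, Function.comp_apply, smul_inv_smul]

/-- The induced map `π̂ : K → O(L^p(K ⧸ Γ; E))`,
`(π̂(g) f)(x) = π(β(g⁻¹, x)⁻¹) f(g⁻¹ x)`. -/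
noncomputable def inducedRep {K : Type*} [Group K] [TopologicalSpace K] [IsTopologicalGroup K]
    [T2Space K] [SecondCountableTopology K] [MeasurableSpace K] [BorelSpace K]
    {Γ : Subgroup K} (hΓ : DiscreteTopology Γ) (s : BoundedBorelSection Γ) (m : Measure (K ⧸ Γ))
    [SMulInvariantMeasure K (K ⧸ Γ) m] (p : ℝ≥0∞) [Fact (1 ≤ p)]
    {E : Type*} [NormedAddCommGroup E] [NormedSpace ℝ E]
    (π : Γ → (E ≃ₗᵢ[ℝ] E)) (g : K) : Lp E p m ≃ₗᵢ[ℝ] Lp E p m :=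
  have : Countable Γ := countable_of_Lindelof_of_discrete
  (translationIsometry m p E g).trans (fiberwiseIsometry m p (measurable_beta_inv s g⁻¹) π)

theorem inducedRep_apply {K : Type*} [Group K] [TopologicalSpace K] [IsTopologicalGroup K]
    [T2Space K] [SecondCountableTopology K] [MeasurableSpace K] [BorelSpace K]
    {Γ : Subgroup K} (hΓ : DiscreteTopology Γ) (s : BoundedBorelSection Γ) (m : Measure (K ⧸ Γ))
    [SMulInvariantMeasure K (K ⧸ Γ) m] (p : ℝ≥0∞) [Fact (1 ≤ p)]
    {E : Type*} [NormedAddCommGroup E] [NormedSpace ℝ E]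
    (π : Γ → (E ≃ₗᵢ[ℝ] E)) (g : K) (f : Lp E p m) :
    inducedRep hΓ s m p π g f =ᵐ[m] fun x => π (s.beta g⁻¹ x)⁻¹ (f (g⁻¹ • x)) := by
  have : Countable Γ := countable_of_Lindelof_of_discrete
  have h₁ := (memLp_fiberwise (measurable_beta_inv s g⁻¹) π
    (translationIsometry m p E g f)).coeFn_toLp
  have h₂ := Lp.coeFn_compMeasurePreserving f (measurePreserving_smul_coset m g⁻¹)
  filter_upwards [h₁, h₂] with x hx₁ hx₂
  exact hx₁.trans (congrArg _ hx₂)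

/-- The induced map `b̂ : K → L^p(K ⧸ Γ; E)`, `b̂(g)(x) = b(β(g⁻¹, x)⁻¹)`. -/
noncomputable def inducedCocycle {K : Type*} [Group K] [TopologicalSpace K] [IsTopologicalGroup K]
    [T2Space K] [SecondCountableTopology K] [MeasurableSpace K] [BorelSpace K]
    {Γ : Subgroup K} (hΓ : DiscreteTopology Γ) (s : BoundedBorelSection Γ) (m : Measure (K ⧸ Γ))
    [IsFiniteMeasure m] (p : ℝ≥0∞) {E : Type*} [NormedAddCommGroup E]
    (b : Γ → E) (g : K) : Lp E p m :=
  (memLp_inducedCocycle hΓ s m p b g).toLp _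

/-- The pair `(π̂, b̂) = (m, s)-Ind_Γ^K (π, b)` induced from `(π, b)` by means of the invariant
probability measure `m` on `K ⧸ Γ` and the bounded Borel section `s`. -/
noncomputable def inducedPair {K : Type*} [Group K] [TopologicalSpace K] [IsTopologicalGroup K]
    [T2Space K] [SecondCountableTopology K] [MeasurableSpace K] [BorelSpace K]
    {Γ : Subgroup K} (hΓ : DiscreteTopology Γ) (s : BoundedBorelSection Γ) (m : Measure (K ⧸ Γ))
    [IsProbabilityMeasure m] [SMulInvariantMeasure K (K ⧸ Γ) m] (p : ℝ≥0∞) [Fact (1 ≤ p)]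
    {E : Type*} [NormedAddCommGroup E] [NormedSpace ℝ E]
    (ρ : (Γ → (E ≃ₗᵢ[ℝ] E)) × (Γ → E)) :
    (K → (Lp E p m ≃ₗᵢ[ℝ] Lp E p m)) × (K → Lp E p m) :=
  (inducedRep hΓ s m p ρ.1, inducedCocycle hΓ s m p ρ.2)

/-! Put `N γ = ‖b γ⁻¹‖`. The defect bound makes `N` a quasi-length: subadditive and symmetric up to
a constant. If the induced cocycle is bounded on `G`, Chebyshev's inequality gives, for each `ε`, an
`R` such that `{x | R < N (β g x)}` has measure at most `ε` for all `g ∈ G` at once.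

Let `γ` lie over `W`, let `v` be its `G`-coordinate and `C ⊂ G` a compact set. A step `ξ` from `y`
is useful if it carries some point of `C × Q` over `y` into `C v` in the `G`-coordinate. For such a
step `γ` differs from `β ξ y` only by factors from two finite sets that depend on `W` but not on
`γ`, so one useful step with `N (β ξ y)` bounded is enough. Useful steps have `ξ ∈ S = C v C⁻¹`. The
difficulty is that `μ S` may be unbounded as `γ` varies, so that the useful steps may be rarer than
`ε` and all of them bad.

The remedy is a long random walk on `G` with steps uniform in `S` and a weight `ρ`, supported on
useful steps, whose average over the steps from any point lies between `1` and a constant `k`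
independent of `γ`. For a walk of length `L > sup ρ` the total weight has mean at least `L` and
second moment at most of order `k² L²`, so it cannot concentrate on a small set. Hence some useful
step `ξ`, with increments `g₁` before and `g₂` after it, avoids the bad set for `g₁`, for `g₂` and
for `g₂ ξ g₁`. The cocycle identity `β (g₂ ξ g₁) x = β g₂ (ξ g₁ x) * β ξ (g₁ x) * β g₁ x` then
bounds `N (β ξ (g₁ x))` by `3 R` plus a constant. `L` depends on `γ`, but `R` does not, since it
serves all `g`. See `exists_weighted_step` and `quasiLength_bounded_of_cocycle`. The averages of `ρ`
are computed with a two-sided invariant Haar measure on `G`, which exists because the lattice makes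
`G × H` unimodular (`modularCharacter_eq_one`).

For (2), `Λ^∞` contains all elements of `Γ` over some open subgroup `U` of `H`
(`exists_isOpen_subgroup_closure_modelSet`). With a bounded Borel section valued in `G × U`, the
cocycle `β` on `G` takes values in `Λ^∞`. Inducing from `Λ^∞` straight to `G` gives a pair of the
same type on `L^p(Y; E)`, which is an `L^p`-space by Fubini; its cocycle is bounded by hypothesis,
and the argument above applies. -/

set_option linter.unusedSectionVars false

/-! ### Weighted random walks: moments of the total weight and the law of a marked step -/

section RandomWalk

variable {G X : Type*} [Group G] [MeasurableSpace G] [MeasurableMul₂ G] [MeasurableSpace X]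
  [MulAction G X] [MeasurableSMul₂ G X]

/-- The law of `(x, g, z)` after `n` steps of the random walk on `G` with step distribution `θ`,
started at the identity: `x` is the independent initial point, `g` is the position, and `z` is the
accumulated weight `∑ ρ (g_{i-1} • x, ξ_i)`. -/
noncomputable def walkLaw (m : Measure X) (θ : Measure G) (ρ : X × G → ℝ≥0∞) :
    ℕ → Measure (X × G × ℝ≥0∞)
  | 0 => m.map fun x => (x, 1, 0)
  | n + 1 => ((walkLaw m θ ρ n).prod θ).map
      fun q => (q.1.1, q.2 * q.1.2.1, q.1.2.2 + ρ (q.1.2.1 • q.1.1, q.2))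

/-- The weighted law of `(x, g₁, ξ, g₂)` for the random walk of length `n`, where a step `ξ` is
marked with weight `ρ`, and `g₁` and `g₂` are the positions before and after the marked step. -/
noncomputable def markedLaw (m : Measure X) (θ : Measure G) (ρ : X × G → ℝ≥0∞) :
    ℕ → Measure (X × G × G × G)
  | 0 => 0
  | n + 1 => ((markedLaw m θ ρ n).prod θ).map
        (fun q => (q.1.1, q.1.2.1, q.1.2.2.1, q.2 * q.1.2.2.2)) +
      (((walkLaw m θ ρ n).prod θ).withDensity (fun q => ρ (q.1.2.1 • q.1.1, q.2))).map
        (fun q => (q.1.1, q.1.2.1, q.2, 1))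

variable {m : Measure X} {θ : Measure G} {ρ : X × G → ℝ≥0∞}

instance sFinite_walkLaw [SFinite m] [SFinite θ] (n : ℕ) : SFinite (walkLaw m θ ρ n) := by
  induction n with
  | zero => unfold walkLaw; infer_instance
  | succ n ih => unfold walkLaw; infer_instance

instance sFinite_markedLaw [SFinite m] [SFinite θ] (n : ℕ) : SFinite (markedLaw m θ ρ n) := by
  induction n with
  | zero => unfold markedLaw; infer_instance
  | succ n ih => unfold markedLaw; infer_instance

theorem lintegral_walkLaw_zero {F : X × G × ℝ≥0∞ → ℝ≥0∞} (hF : Measurable F) :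
    ∫⁻ q, F q ∂(walkLaw m θ ρ 0) = ∫⁻ x, F (x, 1, 0) ∂m := by
  rw [walkLaw, lintegral_map hF (by fun_prop)]

theorem lintegral_walkLaw_succ [SFinite m] [SFinite θ] (hρ : Measurable ρ) (n : ℕ)
    {F : X × G × ℝ≥0∞ → ℝ≥0∞} (hF : Measurable F) :
    ∫⁻ q, F q ∂(walkLaw m θ ρ (n + 1)) =
      ∫⁻ q, ∫⁻ ξ, F (q.1, ξ * q.2.1, q.2.2 + ρ (q.2.1 • q.1, ξ)) ∂θ ∂(walkLaw m θ ρ n) := by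
  rw [walkLaw, lintegral_map hF (by fun_prop), lintegral_prod _ (by fun_prop)]

theorem lintegral_markedLaw_succ [SFinite m] [SFinite θ] (hρ : Measurable ρ) (n : ℕ)
    {F : X × G × G × G → ℝ≥0∞} (hF : Measurable F) :
    ∫⁻ q, F q ∂(markedLaw m θ ρ (n + 1)) =
      ∫⁻ q, ∫⁻ ξ, F (q.1, q.2.1, q.2.2.1, ξ * q.2.2.2) ∂θ ∂(markedLaw m θ ρ n) +
      ∫⁻ q, ∫⁻ ξ, ρ (q.2.1 • q.1, ξ) * F (q.1, q.2.1, ξ, 1) ∂θ ∂(walkLaw m θ ρ n) := by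
  rw [markedLaw, lintegral_add_measure, lintegral_map hF (by fun_prop),
    lintegral_map hF (by fun_prop), lintegral_prod _ (by fun_prop),
    lintegral_withDensity_eq_lintegral_mul _ (by fun_prop) (by fun_prop),
    lintegral_prod _ (by fun_prop)]
  rfl

/-- The position of the walk is independent of the initial point, so a bound uniform in `g` survives
averaging over positions. -/
theorem lintegral_walkLaw_le [SFinite m] [IsProbabilityMeasure θ] (hρ : Measurable ρ) (n : ℕ)
    {F : X × G → ℝ≥0∞} (hF : Measurable F) {c : ℝ≥0∞} (hc : ∀ g, ∫⁻ x, F (x, g) ∂m ≤ c) :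
    ∫⁻ q, F (q.1, q.2.1) ∂(walkLaw m θ ρ n) ≤ c := by
  induction n generalizing F with
  | zero => rw [lintegral_walkLaw_zero (by fun_prop)]; exact hc 1
  | succ n ih =>
    rw [lintegral_walkLaw_succ hρ n (by fun_prop)]
    refine ih (F := fun q => ∫⁻ ξ, F (q.1, ξ * q.2) ∂θ) (by fun_prop) fun g => ?_
    rw [lintegral_lintegral_swap (by fun_prop)]
    exact (lintegral_mono fun ξ => hc (ξ * g)).trans (by simp)

theorem lintegral_smul_walkLaw [SFinite m] [SMulInvariantMeasure G X m] [IsProbabilityMeasure θ]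
    (hρ : Measurable ρ) (n : ℕ) {f : X → ℝ≥0∞} (hf : Measurable f) :
    ∫⁻ q, f (q.2.1 • q.1) ∂(walkLaw m θ ρ n) ≤ ∫⁻ x, f x ∂m := by
  refine lintegral_walkLaw_le (F := fun q => f (q.2 • q.1)) hρ n (by fun_prop) fun g => ?_
  exact ((measurePreserving_smul g m).lintegral_comp hf).le

theorem walkLaw_univ [IsProbabilityMeasure m] [IsProbabilityMeasure θ]
    (hρ : Measurable ρ) (n : ℕ) : walkLaw m θ ρ n univ = 1 := by
  induction n with
  | zero => rw [← setLIntegral_one, setLIntegral_univ, lintegral_walkLaw_zero (by fun_prop)]; simp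
  | succ n ih =>
    rw [← setLIntegral_one, setLIntegral_univ, lintegral_walkLaw_succ hρ n (by fun_prop)]
    simpa using ih

theorem lintegral_weight_walkLaw_succ [IsProbabilityMeasure m] [IsProbabilityMeasure θ]
    (hρ : Measurable ρ) (n : ℕ) :
    ∫⁻ q, q.2.2 ∂(walkLaw m θ ρ (n + 1)) = ∫⁻ q, q.2.2 ∂(walkLaw m θ ρ n) +
      ∫⁻ q, ∫⁻ ξ, ρ (q.2.1 • q.1, ξ) ∂θ ∂(walkLaw m θ ρ n) := by
  rw [lintegral_walkLaw_succ hρ n (by fun_prop), ← lintegral_add_left (by fun_prop)]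
  refine lintegral_congr fun q => ?_
  rw [lintegral_add_left (by fun_prop)]
  simp

theorem lintegral_weight_walkLaw_le [IsProbabilityMeasure m] [IsProbabilityMeasure θ]
    (hρ : Measurable ρ) {k : ℝ≥0∞} (hk : ∀ x, ∫⁻ ξ, ρ (x, ξ) ∂θ ≤ k) (n : ℕ) :
    ∫⁻ q, q.2.2 ∂(walkLaw m θ ρ n) ≤ n * k := by
  induction n with
  | zero => rw [lintegral_walkLaw_zero (by fun_prop)]; simp
  | succ n ih =>
    rw [lintegral_weight_walkLaw_succ hρ]
    refine (add_le_add ih (lintegral_mono fun q => hk _)).trans ?_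
    rw [lintegral_const, walkLaw_univ hρ]
    push_cast
    rw [add_mul]
    simp

theorem le_lintegral_weight_walkLaw [IsProbabilityMeasure m] [IsProbabilityMeasure θ]
    (hρ : Measurable ρ) (h1 : ∀ x, 1 ≤ ∫⁻ ξ, ρ (x, ξ) ∂θ) (n : ℕ) :
    n ≤ ∫⁻ q, q.2.2 ∂(walkLaw m θ ρ n) := by
  induction n with
  | zero => simp
  | succ n ih =>
    rw [lintegral_weight_walkLaw_succ hρ]
    push_cast
    refine add_le_add ih ?_
    calc (1 : ℝ≥0∞) = ∫⁻ q, 1 ∂(walkLaw m θ ρ n) := by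
          rw [lintegral_const, walkLaw_univ hρ, one_mul]
      _ ≤ _ := lintegral_mono fun q => h1 _

/-- Cross terms contribute at most `2 k` times the mean, and squares `ρ ^ 2 ≤ M ρ` only `M k` per
step. Once `n` exceeds `M`, the linear term is dominated by `n ^ 2 * k`. -/
theorem lintegral_sq_weight_walkLaw_le [IsProbabilityMeasure m] [IsProbabilityMeasure θ]
    (hρ : Measurable ρ) {k M : ℝ≥0∞} (hk : ∀ x, ∫⁻ ξ, ρ (x, ξ) ∂θ ≤ k) (hM : ∀ q, ρ q ≤ M)
    (n : ℕ) :
    ∫⁻ q, q.2.2 ^ 2 ∂(walkLaw m θ ρ n) ≤ n ^ 2 * k ^ 2 + n * (M * k) := by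
  induction n with
  | zero => rw [lintegral_walkLaw_zero (by fun_prop)]; simp
  | succ n ih =>
    rw [lintegral_walkLaw_succ hρ n (by fun_prop)]
    have key : ∀ q : X × G × ℝ≥0∞, ∫⁻ ξ, (q.2.2 + ρ (q.2.1 • q.1, ξ)) ^ 2 ∂θ ≤
        q.2.2 ^ 2 + q.2.2 * (2 * k) + M * k := fun q => by
      calc ∫⁻ ξ, (q.2.2 + ρ (q.2.1 • q.1, ξ)) ^ 2 ∂θ
          ≤ ∫⁻ ξ, (q.2.2 ^ 2 + (2 * q.2.2) * ρ (q.2.1 • q.1, ξ)) + M * ρ (q.2.1 • q.1, ξ) ∂θ := by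
            refine lintegral_mono fun ξ => ?_
            rw [add_sq, sq (ρ _)]
            gcongr
            exact hM _
        _ ≤ _ := by
            rw [lintegral_add_left (by fun_prop), lintegral_add_left (by fun_prop),
              lintegral_const_mul _ (by fun_prop), lintegral_const_mul _ (by fun_prop)]
            refine (add_le_add_left (add_le_add_right (mul_le_mul_right (hk _) _) _) _).trans ?_
            refine (add_le_add_right (mul_le_mul_right (hk _) _) _).trans ?_
            simp only [lintegral_const, measure_univ, mul_one]
            apply le_of_eq
            ring
    refine (lintegral_mono key).trans ?_
    rw [lintegral_add_left (by fun_prop), lintegral_add_left (by fun_prop),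
      lintegral_mul_const _ (by fun_prop), lintegral_const, walkLaw_univ hρ]
    have := lintegral_weight_walkLaw_le (m := m) hρ hk n
    calc _ ≤ n ^ 2 * k ^ 2 + n * (M * k) + n * k * (2 * k) + M * k * 1 := by gcongr
      -- The slack `k ^ 2` completes the square `(n + 1) ^ 2 * k ^ 2`.
      _ ≤ n ^ 2 * k ^ 2 + n * (M * k) + n * k * (2 * k) + M * k * 1 + k ^ 2 := le_self_add
      _ = _ := by push_cast; ring

/-- The product of the three increments is the end point of the walk, whichever step is marked;
summing the weights over all possible marks gives the accumulated weight. -/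
theorem lintegral_markedLaw_total [IsProbabilityMeasure m] [IsProbabilityMeasure θ]
    (hρ : Measurable ρ) (n : ℕ) {f : X × G → ℝ≥0∞} (hf : Measurable f) :
    ∫⁻ q, f (q.1, q.2.2.2 * (q.2.2.1 * q.2.1)) ∂(markedLaw m θ ρ n) =
      ∫⁻ q, q.2.2 * f (q.1, q.2.1) ∂(walkLaw m θ ρ n) := by
  induction n generalizing f with
  | zero => rw [lintegral_walkLaw_zero (by fun_prop)]; simp [markedLaw]
  | succ n ih =>
    rw [lintegral_markedLaw_succ hρ n (by fun_prop), lintegral_walkLaw_succ hρ n (by fun_prop)]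
    have := ih (f := fun q => ∫⁻ ξ, f (q.1, ξ * q.2) ∂θ) (by fun_prop)
    simp only [mul_assoc] at this ⊢
    rw [this, ← lintegral_add_left (by fun_prop)]
    refine lintegral_congr fun q => ?_
    rw [← lintegral_const_mul _ (by fun_prop), ← lintegral_add_left (by fun_prop)]
    simp only [one_mul, add_mul]

theorem lintegral_markedLaw_before_le [IsProbabilityMeasure m] [IsProbabilityMeasure θ]
    (hρ : Measurable ρ) {k : ℝ≥0∞} (hk : ∀ x, ∫⁻ ξ, ρ (x, ξ) ∂θ ≤ k) (n : ℕ)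
    {F : X × G → ℝ≥0∞} (hF : Measurable F) {c : ℝ≥0∞} (hc : ∀ g, ∫⁻ x, F (x, g) ∂m ≤ c) :
    ∫⁻ q, F (q.1, q.2.1) ∂(markedLaw m θ ρ n) ≤ n * (k * c) := by
  induction n with
  | zero => simp [markedLaw]
  | succ n ih =>
    rw [lintegral_markedLaw_succ hρ n (by fun_prop)]
    push_cast
    rw [add_mul, one_mul]
    refine add_le_add (by simpa using ih) ?_
    calc _ ≤ ∫⁻ q, k * F (q.1, q.2.1) ∂(walkLaw m θ ρ n) := by
          refine lintegral_mono fun q => ?_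
          dsimp only
          rw [lintegral_mul_const _ (by fun_prop)]
          gcongr
          exact hk _
      _ ≤ k * c := by
          rw [lintegral_const_mul _ (by fun_prop)]
          gcongr
          exact lintegral_walkLaw_le hρ n hF hc

/-- By invariance of `m`, the point reached by a marked step has density at most `∫⁻ ξ, ρ (ξ⁻¹ • y,
ξ) ∂θ` with respect to `m`. The increments after the mark are independent of that point. -/
theorem lintegral_markedLaw_after_le [IsProbabilityMeasure m] [SMulInvariantMeasure G X m]
    [MeasurableInv G] [IsProbabilityMeasure θ]
    (hρ : Measurable ρ) {k : ℝ≥0∞} (hk : ∀ x, ∫⁻ ξ, ρ (ξ⁻¹ • x, ξ) ∂θ ≤ k) (n : ℕ)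
    {F : X × G → ℝ≥0∞} (hF : Measurable F) {c : ℝ≥0∞} (hc : ∀ g, ∫⁻ x, F (x, g) ∂m ≤ c) :
    ∫⁻ q, F ((q.2.2.1 * q.2.1) • q.1, q.2.2.2) ∂(markedLaw m θ ρ n) ≤ n * (k * c) := by
  induction n generalizing F with
  | zero => simp [markedLaw]
  | succ n ih =>
    rw [lintegral_markedLaw_succ hρ n (by fun_prop)]
    push_cast
    rw [add_mul, one_mul]
    refine add_le_add (ih (F := fun q => ∫⁻ ξ, F (q.1, ξ * q.2) ∂θ) (by fun_prop) fun g => ?_) ?_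
    · rw [lintegral_lintegral_swap (by fun_prop)]
      exact (lintegral_mono fun ξ => hc (ξ * g)).trans (by simp)
    · simp only [mul_smul]
      refine (lintegral_smul_walkLaw (m := m) hρ n
        (f := fun y => ∫⁻ ξ, ρ (y, ξ) * F (ξ • y, 1) ∂θ) (by fun_prop)).trans ?_
      rw [lintegral_lintegral_swap (by fun_prop)]
      calc ∫⁻ ξ, ∫⁻ y, ρ (y, ξ) * F (ξ • y, 1) ∂m ∂θ
          = ∫⁻ ξ, ∫⁻ y, ρ (ξ⁻¹ • y, ξ) * F (y, 1) ∂m ∂θ := by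
            refine lintegral_congr fun ξ => ?_
            rw [← (measurePreserving_smul ξ m).lintegral_comp
              (f := fun y => ρ (ξ⁻¹ • y, ξ) * F (y, 1)) (by fun_prop)]
            simp only [inv_smul_smul]
        _ = ∫⁻ y, (∫⁻ ξ, ρ (ξ⁻¹ • y, ξ) ∂θ) * F (y, 1) ∂m := by
            rw [lintegral_lintegral_swap (by fun_prop)]
            refine lintegral_congr fun y => ?_
            rw [lintegral_mul_const _ (by fun_prop)]
        _ ≤ ∫⁻ y, k * F (y, 1) ∂m := lintegral_mono fun y => by gcongr; exact hk y
        _ ≤ k * c := by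
            rw [lintegral_const_mul _ (by fun_prop)]
            gcongr
            exact hc 1

theorem lintegral_markedLaw_indicator [IsProbabilityMeasure m] [IsProbabilityMeasure θ]
    (hρ : Measurable ρ) (n : ℕ) :
    ∫⁻ q, (ρ ⁻¹' {0}).indicator 1 (q.2.1 • q.1, q.2.2.1) ∂(markedLaw m θ ρ n) = 0 := by
  have hm : Measurable ((ρ ⁻¹' {0}).indicator (1 : X × G → ℝ≥0∞)) :=
    measurable_one.indicator (hρ (measurableSet_singleton 0))
  induction n with
  | zero => simp [markedLaw]
  | succ n ih =>
    rw [lintegral_markedLaw_succ hρ n (by fun_prop)]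
    simp only [lintegral_const, measure_univ, mul_one, ih, zero_add]
    have : ∀ q : X × G, ρ q * (ρ ⁻¹' {0}).indicator 1 q = 0 := fun q => by
      by_cases h : ρ q = 0 <;> simp [h, indicator]
    simp [this]

/-- If the weights `ρ` are spread out and the relation `B` is rare, then there is a weighted step
`ξ` from `g₁ • x` which can be closed up by three steps not in `B`. -/
theorem exists_weighted_step [IsProbabilityMeasure m] [SMulInvariantMeasure G X m]
    [MeasurableInv G] [IsProbabilityMeasure θ] (hρ : Measurable ρ) {M : ℝ≥0∞} (hM : M ≠ ∞)
    (hρM : ∀ q, ρ q ≤ M) {k : ℕ} (h1 : ∀ x, 1 ≤ ∫⁻ ξ, ρ (x, ξ) ∂θ)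
    (hk : ∀ x, ∫⁻ ξ, ρ (x, ξ) ∂θ ≤ k) (hk' : ∀ x, ∫⁻ ξ, ρ (ξ⁻¹ • x, ξ) ∂θ ≤ k)
    {B : Set (X × G)} (hB : MeasurableSet B)
    (hBm : ∀ g, 64 * (k : ℝ≥0∞) ^ 2 * m {x | (x, g) ∈ B} ≤ 1) :
    ∃ x g₁ ξ g₂, ρ (g₁ • x, ξ) ≠ 0 ∧ (x, g₁) ∉ B ∧ ((ξ * g₁) • x, g₂) ∉ B ∧
      (x, g₂ * (ξ * g₁)) ∉ B := by
  by_contra! H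
  have : Nonempty X := m.nonempty_of_neZero
  have hk1 : 1 ≤ k := by
    have := (h1 (Classical.arbitrary X)).trans (hk _)
    exact_mod_cast this
  -- The length exceeds the largest weight, so the second moment is at most `L² k² + L² k`.
  obtain ⟨L, hL⟩ := ENNReal.exists_nat_gt hM
  have hL1 : 1 ≤ L := by
    by_contra! h
    obtain rfl : L = 0 := by omega
    simp at hL
  -- `c` bounds the measure of each slice of `B`; `T` is the level at which the total weight is
  -- truncated, a large multiple of its mean.
  set c : NNReal := (64 * (k : NNReal) ^ 2)⁻¹ with hc
  set T : NNReal := 8 * (k : NNReal) ^ 2 * L with hT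
  have hk0 : (k : NNReal) ≠ 0 := by positivity
  have hL0 : (L : NNReal) ≠ 0 := by positivity
  have hc0 : 64 * (k : NNReal) ^ 2 ≠ 0 := by positivity
  have hT0 : T ≠ 0 := by positivity
  have hTE : (T : ℝ≥0∞) ≠ 0 := by exact_mod_cast hT0
  let b : X × G → ℝ≥0∞ := B.indicator 1
  have hb : Measurable b := measurable_one.indicator hB
  have hbc : ∀ g, ∫⁻ x, b (x, g) ∂m ≤ c := fun g => by
    have : ∫⁻ x, b (x, g) ∂m = m {x | (x, g) ∈ B} :=
      lintegral_indicator_one (μ := m) (s := {x | (x, g) ∈ B}) (measurable_prodMk_right hB)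
    rw [this, hc, ENNReal.coe_inv hc0, ENNReal.le_inv_iff_mul_le, mul_comm]
    exact_mod_cast hBm g
  have hzero : Measurable ((ρ ⁻¹' {0}).indicator (1 : X × G → ℝ≥0∞)) :=
    measurable_one.indicator (hρ (measurableSet_singleton 0))
  -- The marked law has mass at least `L`. By `H`, each marked walk either has a mark of weight
  -- zero, a null event, or meets `B` in one of three places.
  have hsplit : (L : ℝ≥0∞) ≤ L * (k * c) + L * (k * c) +
      ∫⁻ q, q.2.2 * b (q.1, q.2.1) ∂(walkLaw m θ ρ L) := by
    calc (L : ℝ≥0∞) ≤ ∫⁻ q, q.2.2 ∂(walkLaw m θ ρ L) := le_lintegral_weight_walkLaw hρ h1 L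
      _ = ∫⁻ q, 1 ∂(markedLaw m θ ρ L) := by
          simpa using (lintegral_markedLaw_total (m := m) (θ := θ) hρ L
            (f := fun _ => 1) measurable_const).symm
      _ ≤ ∫⁻ q, (ρ ⁻¹' {0}).indicator 1 (q.2.1 • q.1, q.2.2.1) + b (q.1, q.2.1) +
            b ((q.2.2.1 * q.2.1) • q.1, q.2.2.2) +
            b (q.1, q.2.2.2 * (q.2.2.1 * q.2.1)) ∂(markedLaw m θ ρ L) := by
          refine lintegral_mono fun q => ?_
          by_cases h0 : ρ (q.2.1 • q.1, q.2.2.1) = 0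
          · simp [indicator, h0, add_assoc]
          by_cases hb1 : (q.1, q.2.1) ∈ B
          · simp [b, indicator, hb1, add_assoc, h0]
          by_cases hb2 : ((q.2.2.1 * q.2.1) • q.1, q.2.2.2) ∈ B
          · simp only [b, indicator, hb2, if_true, Pi.one_apply, add_assoc]
            exact le_add_left (le_add_left le_self_add)
          · simp [b, indicator, H _ _ _ _ h0 hb1 hb2]
      _ ≤ 0 + L * (k * c) + L * (k * c) +
            ∫⁻ q, q.2.2 * b (q.1, q.2.1) ∂(walkLaw m θ ρ L) := by
          rw [lintegral_add_left (by fun_prop), lintegral_add_left (by fun_prop),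
            lintegral_add_left (by fun_prop), lintegral_markedLaw_indicator hρ,
            lintegral_markedLaw_total hρ L hb]
          gcongr
          · exact lintegral_markedLaw_before_le hρ hk L hb hbc
          · exact lintegral_markedLaw_after_le hρ hk' L hb hbc
      _ = _ := by rw [zero_add]
  -- Truncation: `z b ≤ T b + z² / T`, according to whether `z ≤ T` or `z ≥ T`. Both terms are
  -- averaged separately.
  have hz : ∫⁻ q, q.2.2 * b (q.1, q.2.1) ∂(walkLaw m θ ρ L) ≤
      T * c + (T : ℝ≥0∞)⁻¹ * (L ^ 2 * k ^ 2 + L * (L * k)) := by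
    calc _ ≤ ∫⁻ q, T * b (q.1, q.2.1) + (T : ℝ≥0∞)⁻¹ * q.2.2 ^ 2 ∂(walkLaw m θ ρ L) := by
          refine lintegral_mono fun q => ?_
          dsimp only
          rcases le_total q.2.2 T with h | h
          · exact le_add_right (by gcongr)
          · refine le_add_left ?_
            calc q.2.2 * b (q.1, q.2.1) ≤ q.2.2 * 1 := by
                  gcongr
                  exact indicator_le_self' (by simp) _
              _ = (T : ℝ≥0∞)⁻¹ * (T * q.2.2) := by
                  rw [← mul_assoc, ENNReal.inv_mul_cancel hTE (by simp), one_mul, mul_one]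
              _ ≤ (T : ℝ≥0∞)⁻¹ * (q.2.2 * q.2.2) := by gcongr
              _ = _ := by rw [sq]
      _ ≤ _ := by
          rw [lintegral_add_left (by fun_prop), lintegral_const_mul _ (by fun_prop),
            lintegral_const_mul _ (by fun_prop)]
          gcongr
          · exact lintegral_walkLaw_le hρ L hb hbc
          · refine (lintegral_sq_weight_walkLaw_le hρ hk hρM L).trans ?_
            gcongr
  have hfin : (L : NNReal) ≤ L * (k * c) + L * (k * c) +
      (T * c + T⁻¹ * (L ^ 2 * k ^ 2 + L * (L * k))) := by
    have := hsplit.trans (add_le_add_right hz _)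
    rw [← ENNReal.coe_inv hT0] at this
    exact_mod_cast this
  have hk1' : (1 : ℝ) ≤ k := by exact_mod_cast hk1
  have hL1' : (1 : ℝ) ≤ L := by exact_mod_cast hL1
  have hfin' : (L : ℝ) ≤ L * (k * (64 * (k : ℝ) ^ 2)⁻¹) + L * (k * (64 * (k : ℝ) ^ 2)⁻¹) +
      ((8 * (k : ℝ) ^ 2 * L) * (64 * (k : ℝ) ^ 2)⁻¹ +
        (8 * (k : ℝ) ^ 2 * L)⁻¹ * ((L : ℝ) ^ 2 * (k : ℝ) ^ 2 + L * (L * k))) := by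
    have := NNReal.coe_le_coe.2 hfin
    rw [hc, hT] at this
    push_cast at this
    exact this
  -- Altogether `L ≤ (2 / 64 + 1 / 8 + 1 / 4) L`, which is absurd for `L ≥ 1`.
  have e1 : (k : ℝ) * (64 * (k : ℝ) ^ 2)⁻¹ ≤ 1 / 64 := by
    rw [← div_eq_mul_inv, div_le_div_iff₀ (by positivity) (by positivity)]
    nlinarith
  have e2 : (8 * (k : ℝ) ^ 2 * L) * (64 * (k : ℝ) ^ 2)⁻¹ = L / 8 := by field_simp; norm_num
  have e3 : (8 * (k : ℝ) ^ 2 * L)⁻¹ * ((L : ℝ) ^ 2 * (k : ℝ) ^ 2 + L * (L * k)) ≤ L / 4 := by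
    rw [inv_mul_le_iff₀ (by positivity)]
    nlinarith [mul_le_mul_of_nonneg_left hk1' (by positivity : 0 ≤ (k : ℝ) * L ^ 2)]
  have e4 := mul_le_mul_of_nonneg_left e1 (by positivity : (0 : ℝ) ≤ L)
  linarith

end RandomWalk

/-! ### Quasi-lengths that are small along a cocycle -/

theorem tsum_le_ncard_mul {D : Type*} {A : Set D} (hA : A.Finite) {f : D → ℝ≥0∞} {c : ℝ≥0∞}
    (h0 : ∀ d ∉ A, f d = 0) (hc : ∀ d, f d ≤ c) : ∑' d, f d ≤ A.ncard * c := by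
  rw [tsum_eq_sum (s := hA.toFinset) (by simpa using h0), ncard_eq_toFinset_card A hA,
    ← nsmul_eq_mul]
  exact Finset.sum_le_card_nsmul _ _ _ fun d _ => hc d

theorem lintegral_cond_of_support {G : Type*} [MeasurableSpace G] {μ : Measure G} {S : Set G}
    (hS : MeasurableSet S) {f : G → ℝ≥0∞} (hf : ∀ x ∉ S, f x = 0) :
    ∫⁻ x, f x ∂(ProbabilityTheory.cond μ S) = (μ S)⁻¹ * ∫⁻ x, f x ∂μ := by
  rw [ProbabilityTheory.cond, lintegral_smul_measure, ← lintegral_indicator hS, smul_eq_mul,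
    indicator_eq_self.2 fun x hx => by_contra fun h => hx (hf x h)]

section Thickening

variable {G H : Type*}
    [Group G] [TopologicalSpace G] [IsTopologicalGroup G] [T2Space G] [LocallyCompactSpace G]
    [SecondCountableTopology G] [MeasurableSpace G] [BorelSpace G]
    [Group H] [TopologicalSpace H] [IsTopologicalGroup H] [T2Space H]
    [SecondCountableTopology H] [MeasurableSpace H] [BorelSpace H]
    {X : Type*} [MeasurableSpace X] [MulAction G X] [MeasurableSMul₂ G X]
    {D : Type*} [Group D] [Countable D]

/-- The number of pairs `(k, c) ∈ (C × Q) × C` with `k` over `x` and `c * v = ξ * k.1`. -/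
noncomputable def stepWeight (j : D →* G × H) (s : X → G × H) (C : Set G) (Q : Set H) (v : G)
    (q : X × G) : ℝ≥0∞ :=
  ∑' d, C.indicator 1 (s q.1 * j d).1 * Q.indicator 1 (s q.1 * j d).2 *
    C.indicator 1 (q.2 * (s q.1 * j d).1 * v⁻¹)

variable {j : D →* G × H} {s : X → G × H} {C : Set G} {Q : Set H}

theorem measurable_stepWeight (hs : Measurable s) (hC : MeasurableSet C) (hQ : MeasurableSet Q)
    (v : G) : Measurable (stepWeight j s C Q v) := by
  have h1 : Measurable (C.indicator (1 : G → ℝ≥0∞)) := measurable_one.indicator hC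
  have h2 : Measurable (Q.indicator (1 : H → ℝ≥0∞)) := measurable_one.indicator hQ
  unfold stepWeight
  refine Measurable.tsum fun d => ?_
  fun_prop

theorem exists_of_stepWeight_ne_zero {v : G} {x : X} {ξ : G} (h : stepWeight j s C Q v (x, ξ) ≠ 0) :
    ∃ d, (s x * j d).1 ∈ C ∧ (s x * j d).2 ∈ Q ∧ ξ * (s x * j d).1 * v⁻¹ ∈ C := by
  by_contra! H
  refine h (ENNReal.tsum_eq_zero.2 fun d => ?_)
  by_cases h1 : (s x * j d).1 ∈ C
  · by_cases h2 : (s x * j d).2 ∈ Q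
    · rw [indicator_of_notMem (H d h1 h2), mul_zero]
    · rw [indicator_of_notMem h2, mul_zero, zero_mul]
  · rw [indicator_of_notMem h1, zero_mul, zero_mul]

/-- For each point `k` over `x`, right invariance gives the set of `ξ` with `ξ * k.1 * v⁻¹ ∈ C` the
measure of `C`, whatever `v` is. -/
theorem lintegral_stepWeight (hC : MeasurableSet C)
    (μ : Measure G) [μ.IsMulRightInvariant] (v : G) (x : X) :
    ∫⁻ ξ, stepWeight j s C Q v (x, ξ) ∂μ =
      ∑' d, C.indicator 1 (s x * j d).1 * Q.indicator 1 (s x * j d).2 * μ C := by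
  have h1 : Measurable (C.indicator (1 : G → ℝ≥0∞)) := measurable_one.indicator hC
  have h2 : ∀ d, Measurable fun ξ => C.indicator (1 : G → ℝ≥0∞) (ξ * (s x * j d).1 * v⁻¹) :=
    fun d => h1.comp ((measurable_id.mul_const _).mul_const _)
  simp only [stepWeight]
  rw [lintegral_tsum fun d => ((h2 d).const_mul _).aemeasurable]
  refine tsum_congr fun d => ?_
  rw [lintegral_const_mul _ (h2 d)]
  congr 1
  simp only [mul_assoc]
  rw [lintegral_mul_right_eq_self (fun ξ => C.indicator (1 : G → ℝ≥0∞) ξ),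
    lintegral_indicator_one hC]

/-- Time reversal: a useful step into `x` is seen from its end point, whose lift lies in `C × Q'`,
where `Q'` absorbs the `H`-coordinate of `γ`. Left invariance then applies to `ξ⁻¹`. -/
theorem lintegral_stepWeight_inv_le (hC : MeasurableSet C) (μ : Measure G) [μ.IsMulLeftInvariant]
    {β : G → X → D} (hβ : ∀ g x, s (g • x) * j (β g x) = (g, 1) * s x)
    {Q' : Set H} {γ : D} (hQ' : ∀ h, h * (j γ).2 ∈ Q → h ∈ Q') (x : X) :
    ∫⁻ ξ, stepWeight j s C Q (j γ).1 (ξ⁻¹ • x, ξ) ∂μ ≤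
      ∑' d, C.indicator 1 (s x * j d).1 * Q'.indicator 1 (s x * j d).2 * μ C⁻¹ := by
  have h1 : Measurable (C.indicator (1 : G → ℝ≥0∞)) := measurable_one.indicator hC
  calc _ ≤ ∫⁻ ξ, ∑' d, C.indicator 1 (s x * j d).1 * Q'.indicator 1 (s x * j d).2 *
        C.indicator 1 (ξ⁻¹ * ((s x * j d).1 * (j γ).1)) ∂μ := by
        refine lintegral_mono fun ξ => ?_
        dsimp only [stepWeight]
        set u := β ξ (ξ⁻¹ • x) with hu
        -- Lifts of `ξ⁻¹ • x` are parametrised by lifts of `x`: translate by `ξ⁻¹`, then multiply by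
        -- `γ` on the right. This exchanges the two conditions involving `C`.
        rw [← ((Equiv.mulLeft u⁻¹).trans (Equiv.mulRight γ)).tsum_eq]
        refine ENNReal.tsum_le_tsum fun d => ?_
        have e : s (ξ⁻¹ • x) * j (u⁻¹ * d * γ) = (ξ⁻¹, 1) * (s x * j d) * j γ := by
          have := hβ ξ (ξ⁻¹ • x)
          rw [smul_inv_smul, ← hu] at this
          have h3 : s (ξ⁻¹ • x) = (ξ⁻¹, 1) * (s x * j u) := by
            rw [this, ← mul_assoc]
            simp
          rw [h3, map_mul, map_mul, map_inv]
          group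
        simp only [Equiv.trans_apply, Equiv.coe_mulLeft, Equiv.coe_mulRight, e, Prod.fst_mul,
          Prod.snd_mul, one_mul]
        have e2 : ξ * (ξ⁻¹ * ((s x).1 * (j d).1) * (j γ).1) * (j γ).1⁻¹ = (s x).1 * (j d).1 := by
          group
        rw [e2, mul_comm, mul_comm (C.indicator 1 _) (Q.indicator 1 _), ← mul_assoc (C.indicator 1 _)]
        gcongr
        · by_cases h3 : (s x).2 * (j d).2 * (j γ).2 ∈ Q
          · rw [indicator_of_mem h3, indicator_of_mem (hQ' _ h3)]
            rfl
          · rw [indicator_of_notMem h3]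
            exact bot_le
        · exact le_of_eq (by simp only [mul_assoc])
      _ = _ := by
        have h2 : ∀ d, Measurable fun ξ =>
            C.indicator (1 : G → ℝ≥0∞) (ξ⁻¹ * ((s x * j d).1 * (j γ).1)) :=
          fun d => h1.comp (measurable_inv.mul_const _)
        rw [lintegral_tsum fun d => ((h2 d).const_mul _).aemeasurable]
        refine tsum_congr fun d => ?_
        rw [lintegral_const_mul _ (h2 d), ← lintegral_indicator_one hC.inv,
          ← lintegral_mul_left_eq_self (C⁻¹.indicator (1 : G → ℝ≥0∞))
            ((s x * j d).1 * (j γ).1)⁻¹]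
        congr 1
        refine lintegral_congr fun ξ => ?_
        have hmem : ((s x * j d).1 * (j γ).1)⁻¹ * ξ ∈ C⁻¹ ↔ ξ⁻¹ * ((s x * j d).1 * (j γ).1) ∈ C := by
          rw [Set.mem_inv, mul_inv_rev, inv_inv]
        by_cases h : ξ⁻¹ * ((s x * j d).1 * (j γ).1) ∈ C
        · rw [indicator_of_mem h, indicator_of_mem (hmem.2 h)]
          rfl
        · rw [indicator_of_notMem h, indicator_of_notMem (mt hmem.1 h)]

theorem cocycle_mul (hj : Function.Injective j) {β : G → X → D}
    (hβ : ∀ g x, s (g • x) * j (β g x) = (g, 1) * s x) (g h : G) (x : X) :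
    β (g * h) x = β g (h • x) * β h x := by
  apply hj
  rw [← mul_right_inj (s ((g * h) • x)), hβ, map_mul, mul_smul, ← mul_assoc, hβ, mul_assoc, hβ,
    ← mul_assoc]
  simp

/-- Let `N` be a quasi-length on `D`, and suppose that the cocycle `β` has small `N`-length
uniformly in measure. Then `N` is bounded on the elements of `D` over the compact set `W`. -/
theorem quasiLength_bounded_of_cocycle {m : Measure X} [IsProbabilityMeasure m]
    [SMulInvariantMeasure G X m] (μ : Measure G) [μ.IsHaarMeasure] [μ.IsMulRightInvariant]
    (hj : Function.Injective j) (hfin : ∀ P : Set (G × H), IsCompact P → {d | j d ∈ P}.Finite)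
    (hs : Measurable s) {P : Set (G × H)} (hP : IsCompact P) (hsP : ∀ x, s x ∈ P)
    {β : G → X → D} (hβ : ∀ g x, s (g • x) * j (β g x) = (g, 1) * s x)
    {W : Set H} (hW : IsCompact W) {N : D → ℝ} {c : ℝ}
    (hmul : ∀ d e, N (d * e) ≤ N d + N e + c) (hinv : ∀ d, N d⁻¹ ≤ N d + c)
    (hmeas : ∀ R, MeasurableSet {q : X × G | R < N (β q.2 q.1)})
    (hsmall : ∀ ε : ℝ≥0∞, ε ≠ 0 → ∃ R, ∀ g, m {x | R < N (β g x)} ≤ ε) :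
    ∃ R, ∀ d, (j d).2 ∈ W → N d ≤ R := by
  obtain ⟨K, hK, hK1⟩ := exists_compact_mem_nhds (1 : G)
  -- `C` contains the `G`-coordinates of the section, so every `x` has a lift in `C × Q`; `K` makes
  -- it a neighbourhood of `1`, so that `μ C ≠ 0`.
  set C : Set G := Prod.fst '' P ∪ K with hCdef
  set Q : Set H := Prod.snd '' P
  have hCc : IsCompact C := (hP.image continuous_fst).union hK
  have hQc : IsCompact Q := hP.image continuous_snd
  have hC : MeasurableSet C := hCc.measurableSet
  have hsC : ∀ x, (s x).1 ∈ C := fun x => Or.inl ⟨_, hsP x, rfl⟩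
  have hsQ : ∀ x, (s x).2 ∈ Q := fun x => ⟨_, hsP x, rfl⟩
  set Q' : Set H := (fun q : H × H => q.1 * q.2⁻¹) '' (Q ×ˢ W)
  have hQ'c : IsCompact Q' := (hQc.prod hW).image (by fun_prop)
  have hquot : ∀ {B : Set H}, IsCompact B →
      {d | j d ∈ (fun q : (G × H) × (G × H) => q.1⁻¹ * q.2) '' (P ×ˢ (C ×ˢ B))}.Finite :=
    fun hB => hfin _ ((hP.prod (hCc.prod hB)).image (by fun_prop))
  have hmem : ∀ {B : Set H} x d, (s x * j d).1 ∈ C → (s x * j d).2 ∈ B →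
      j d ∈ (fun q : (G × H) × (G × H) => q.1⁻¹ * q.2) '' (P ×ˢ (C ×ˢ B)) :=
    fun x d h1 h2 => ⟨(s x, s x * j d), ⟨hsP x, h1, h2⟩, by simp⟩
  -- These finite sets contain every `d` with `s x * j d` in `C × Q`, respectively `C × Q'`, for
  -- some `x`. They depend on `W` but not on `γ`; the same holds for `k`, `R`, `R₁` and `R₂` below.
  set A₁ := {d | j d ∈ (fun q : (G × H) × (G × H) => q.1⁻¹ * q.2) '' (P ×ˢ (C ×ˢ Q))}
  set A₂ := {d | j d ∈ (fun q : (G × H) × (G × H) => q.1⁻¹ * q.2) '' (P ×ˢ (C ×ˢ Q'))}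
  have hA₁ : A₁.Finite := hquot hQc
  have hA₂ : A₂.Finite := hquot hQ'c
  have hcount : ∀ {B : Set H} {A : Set D}, A.Finite →
      (∀ x d, (s x * j d).1 ∈ C → (s x * j d).2 ∈ B → d ∈ A) → ∀ x (c : ℝ≥0∞),
      ∑' d, C.indicator 1 (s x * j d).1 * B.indicator 1 (s x * j d).2 * c ≤ A.ncard * c := by
    intro B A hA hBA x c
    refine tsum_le_ncard_mul hA (fun d hd => ?_) fun d => ?_
    · by_cases h1 : (s x * j d).1 ∈ C
      · rw [indicator_of_notMem fun h2 => hd (hBA x d h1 h2)]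
        simp
      · rw [indicator_of_notMem h1, zero_mul, zero_mul]
    · calc _ ≤ 1 * 1 * c := by
            gcongr <;> exact indicator_le_self' (by simp) _
        _ = c := by simp
  have hμC : μ C ≠ 0 :=
    (Measure.measure_pos_of_mem_nhds μ (Filter.mem_of_superset hK1 subset_union_right)).ne'
  have hμC' : μ C ≠ ∞ := hCc.measure_lt_top.ne
  have hμCi : μ C⁻¹ ≠ ∞ := hCc.inv.measure_lt_top.ne
  obtain ⟨k, hk⟩ := ENNReal.exists_nat_gt (r := A₁.ncard + (μ C)⁻¹ * (A₂.ncard * μ C⁻¹))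
    (by finiteness)
  have hε : (64 * (k : ℝ≥0∞) ^ 2)⁻¹ ≠ 0 := by simp; finiteness
  obtain ⟨R, hR⟩ := hsmall _ hε
  obtain ⟨R₁, hR₁⟩ := (hA₁.image N).bddAbove
  obtain ⟨R₂, hR₂⟩ := (hA₂.image N).bddAbove
  have hcoc := cocycle_mul hj hβ
  -- `γ = e⁻¹ * (b * d)` with `N e ≤ R₂`, `N d ≤ R₁` and `N b ≤ 3 * R + 4 * c`; two further products
  -- and one inverse cost `3 * c`.
  refine ⟨R₂ + 3 * R + R₁ + 7 * c, fun γ hγ => ?_⟩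
  set S : Set G := (fun q : G × G => q.1 * (j γ).1 * q.2⁻¹) '' (C ×ˢ C) with hSdef
  have hSc : IsCompact S := (hCc.prod hCc).image (by fun_prop)
  have hS : MeasurableSet S := hSc.measurableSet
  have hstep : ∀ {x ξ}, stepWeight j s C Q (j γ).1 (x, ξ) ≠ 0 → ξ ∈ S := fun {x ξ} h => by
    obtain ⟨d, h1, -, h3⟩ := exists_of_stepWeight_ne_zero h
    exact ⟨(_, _), ⟨h3, h1⟩, by simp [mul_assoc]⟩
  -- As `1 ∈ C`, the set `S` contains a right translate of `C`.
  have hCS : μ C ≤ μ S := by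
    rw [← measure_preimage_mul_right μ (j γ).1 S]
    exact measure_mono fun ξ hξ => ⟨(ξ, 1), ⟨hξ, Or.inr (mem_of_mem_nhds hK1)⟩, by simp⟩
  have hμS : μ S ≠ 0 := fun h => hμC (le_antisymm (hCS.trans h.le) bot_le)
  have hμS' : μ S ≠ ∞ := hSc.measure_lt_top.ne
  have : IsProbabilityMeasure (ProbabilityTheory.cond μ S) :=
    ProbabilityTheory.cond_isProbabilityMeasure_of_finite hμS hμS'
  -- This normalisation makes the average weight at least `1`. It may grow with `γ`, but it enters
  -- only the supremum `M` of the weights, which has no effect on `R`.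
  set a : ℝ≥0∞ := μ S * (μ C)⁻¹ with ha
  have ha' : a ≠ ∞ := by finiteness
  have hint : ∀ y : G → X, ∫⁻ ξ, a * stepWeight j s C Q (j γ).1 (y ξ, ξ) ∂(ProbabilityTheory.cond μ S)
      = (μ C)⁻¹ * ∫⁻ ξ, stepWeight j s C Q (j γ).1 (y ξ, ξ) ∂μ := fun y => by
    rw [lintegral_const_mul' _ _ ha', lintegral_cond_of_support hS
      fun ξ hξ => by_contra fun h => hξ (hstep h), ha, mul_comm (μ S), mul_assoc, ← mul_assoc (μ S),
      ENNReal.mul_inv_cancel hμS hμS', one_mul]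
  have hcount₁ := fun x c => hcount hA₁ (fun x d h1 h2 => hmem x d h1 h2) x c
  have hcount₂ := fun x c => hcount hA₂ (fun x d h1 h2 => hmem x d h1 h2) x c
  obtain ⟨x, g₁, ξ, g₂, hρ, hB₁, hB₂, hB₃⟩ := exists_weighted_step (m := m)
    (θ := ProbabilityTheory.cond μ S) (ρ := fun q => a * stepWeight j s C Q (j γ).1 q)
    ((measurable_stepWeight hs hC hQc.measurableSet _).const_mul _)
    (M := a * (A₁.ncard * 1)) (by finiteness)
    (fun q => by
      refine mul_le_mul_right (le_trans ?_ (hcount₁ q.1 1)) _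
      refine ENNReal.tsum_le_tsum fun d => ?_
      gcongr
      exact indicator_le_self' (by simp) _)
    (k := k)
    (fun x => by
      rw [hint fun _ => x, lintegral_stepWeight hC, ← ENNReal.inv_mul_cancel hμC hμC']
      gcongr
      -- The lift `s x` itself lies in `C × Q`.
      refine le_trans ?_ (ENNReal.le_tsum 1)
      rw [map_one, mul_one, indicator_of_mem (hsC x), indicator_of_mem (hsQ x)]
      simp)
    (fun x => by
      rw [hint fun _ => x, lintegral_stepWeight hC]
      refine (mul_le_mul_right (hcount₁ x _) _).trans (le_trans ?_ hk.le)
      rw [mul_left_comm, ENNReal.inv_mul_cancel hμC hμC', mul_one]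
      exact le_self_add)
    (fun x => by
      rw [hint fun ξ => ξ⁻¹ • x]
      refine (mul_le_mul_right ((lintegral_stepWeight_inv_le hC μ hβ (Q' := Q')
        (fun h hh => ⟨(_, _), ⟨hh, hγ⟩, by simp⟩) x).trans (hcount₂ x _)) _).trans
        (le_trans le_add_self hk.le))
    (hmeas R)
    (fun g => by
      refine (mul_le_mul_right (hR g) _).trans ?_
      exact ENNReal.mul_inv_le_one _)
  simp only [mem_ofPred_eq, not_lt] at hB₁ hB₂ hB₃
  obtain ⟨d, h1, h2, h3⟩ := exists_of_stepWeight_ne_zero (right_ne_zero_of_mul hρ)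
  have hd : d ∈ A₁ := hmem _ d h1 h2
  set b := β ξ (g₁ • x) with hb
  -- The useful step carries the lift `s (g₁ • x) * j d` to a lift of `ξ • g₁ • x` which, after
  -- right multiplication by `(j γ)⁻¹`, lies in `C × Q'`.
  have he : b * d * γ⁻¹ ∈ A₂ := by
    have : s (ξ • g₁ • x) * j (b * d * γ⁻¹) = (ξ, 1) * (s (g₁ • x) * j d) * (j γ)⁻¹ := by
      rw [map_mul, map_mul, map_inv, ← mul_assoc, ← mul_assoc, hβ, mul_assoc (ξ, 1)]
    refine hmem (ξ • g₁ • x) _ ?_ ?_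
    · rw [this]
      exact h3
    · rw [this]
      exact ⟨(_, _), ⟨h2, hγ⟩, by simp⟩
  have hbeq : b = (β g₂ (ξ • g₁ • x))⁻¹ * (β (g₂ * (ξ * g₁)) x * (β g₁ x)⁻¹) := by
    rw [hcoc, hcoc ξ, mul_smul]
    group
    rfl
  have hγeq : γ = (b * d * γ⁻¹)⁻¹ * (b * d) := by group
  have n1 : N b ≤ 3 * R + 4 * c := by
    rw [mul_smul] at hB₂
    have := hmul (β g₂ (ξ • g₁ • x))⁻¹ (β (g₂ * (ξ * g₁)) x * (β g₁ x)⁻¹)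
    have := hmul (β (g₂ * (ξ * g₁)) x) (β g₁ x)⁻¹
    have := hinv (β g₂ (ξ • g₁ • x))
    have := hinv (β g₁ x)
    rw [hbeq]
    linarith
  have := hmul (b * d * γ⁻¹)⁻¹ (b * d)
  have := hinv (b * d * γ⁻¹)
  have := hmul b d
  have := hR₁ ⟨d, hd, rfl⟩
  have := hR₂ ⟨_, he, rfl⟩
  rw [← hγeq] at *
  linarith

end Thickening

/-! ### A group with a lattice and a bounded Borel section is unimodular -/

section Unimodular

variable {K : Type*} [Group K] [TopologicalSpace K] [IsTopologicalGroup K]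
    [T2Space K] [SecondCountableTopology K] [MeasurableSpace K] [BorelSpace K]
    [LocallyCompactSpace K] {Γ : Subgroup K}

theorem BoundedBorelSection.mul_beta (s : BoundedBorelSection Γ) (g : K) (x : K ⧸ Γ) :
    s.toFun (g • x) * s.beta g x = g * s.toFun x := by
  simp [BoundedBorelSection.beta]

theorem finite_mem_of_isCompact (hΓ : DiscreteTopology Γ) {P : Set K} (hP : IsCompact P) :
    {γ : Γ | (γ : K) ∈ P}.Finite := by
  have := (Subgroup.tendsto_coe_cofinite_of_discrete Γ
    (isDiscrete_iff_discreteTopology.2 hΓ)) hP.compl_mem_cocompact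
  rw [Filter.mem_map, Filter.mem_cofinite] at this
  convert this using 1
  ext γ
  simp

/-- The measure on `K` which is the product of `m` with the counting measure on the fibres of
`K → K ⧸ Γ`. -/
noncomputable def liftMeasure (s : BoundedBorelSection Γ) (m : Measure (K ⧸ Γ)) : Measure K :=
  Measure.sum fun γ : Γ => m.map fun x => s.toFun x * γ

theorem lintegral_liftMeasure (hΓ : DiscreteTopology Γ) (s : BoundedBorelSection Γ)
    (m : Measure (K ⧸ Γ)) {f : K → ℝ≥0∞} (hf : Measurable f) :
    ∫⁻ k, f k ∂(liftMeasure s m) = ∫⁻ x, ∑' γ : Γ, f (s.toFun x * γ) ∂m := by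
  have : Countable Γ := countable_of_Lindelof_of_discrete
  have hs := s.measurable_toFun
  rw [liftMeasure, lintegral_sum_measure, lintegral_tsum fun γ => by fun_prop]
  exact tsum_congr fun γ => lintegral_map hf (by fun_prop)

theorem liftMeasure_apply (hΓ : DiscreteTopology Γ) (s : BoundedBorelSection Γ)
    (m : Measure (K ⧸ Γ)) {A : Set K} (hA : MeasurableSet A) :
    liftMeasure s m A = ∫⁻ x, ∑' γ : Γ, A.indicator 1 (s.toFun x * γ) ∂m := by
  rw [← lintegral_indicator_one hA, lintegral_liftMeasure hΓ s m (measurable_one.indicator hA)]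

/-- Left translation by `g` preserves `m` on the base and permutes the fibre sum through `s.beta g
x`. A compact set meets each fibre in boundedly many points, as `Γ` is discrete and the section
bounded. -/
theorem isHaarMeasure_liftMeasure (hΓ : DiscreteTopology Γ) (s : BoundedBorelSection Γ)
    (m : Measure (K ⧸ Γ)) [IsProbabilityMeasure m] [SMulInvariantMeasure K (K ⧸ Γ) m] :
    (liftMeasure s m).IsHaarMeasure := by
  have hΓc : Countable Γ := countable_of_Lindelof_of_discrete
  have hs := s.measurable_toFun
  have hleft : (liftMeasure s m).IsMulLeftInvariant := by
    refine ⟨fun g => Measure.ext fun A hA => ?_⟩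
    have h1 : Measurable (A.indicator (1 : K → ℝ≥0∞)) := measurable_one.indicator hA
    rw [Measure.map_apply (measurable_const_mul g) hA,
      liftMeasure_apply hΓ s m (measurable_const_mul g hA), liftMeasure_apply hΓ s m hA,
      ← (measurePreserving_smul_coset m g).lintegral_comp
        (f := fun x => ∑' γ : Γ, A.indicator 1 (s.toFun x * γ)) (Measurable.tsum fun γ => by fun_prop)]
    refine lintegral_congr fun x => ?_
    rw [← (Equiv.mulLeft (s.beta g x)).tsum_eq fun γ => A.indicator 1 (s.toFun (g • x) * γ)]
    refine tsum_congr fun γ => ?_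
    rw [Equiv.coe_mulLeft, Subgroup.coe_mul, ← mul_assoc, s.mul_beta, mul_assoc]
    rfl
  have hcompact : ∀ P : Set K, IsCompact P → liftMeasure s m P < ∞ := fun P hP => by
    have hA := finite_mem_of_isCompact hΓ
      ((s.bounded.prod hP).image (f := fun q : K × K => q.1⁻¹ * q.2) (by fun_prop))
    rw [liftMeasure_apply hΓ s m hP.measurableSet]
    refine lt_of_le_of_lt (lintegral_mono (g := fun _ => _) fun x => tsum_le_ncard_mul hA
      (c := 1) (fun γ hγ => ?_) fun γ => indicator_le_self' (by simp) _) ?_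
    · exact indicator_of_notMem (fun h => hγ
        ⟨(s.toFun x, s.toFun x * γ), ⟨subset_closure ⟨x, rfl⟩, h⟩, by simp⟩) _
    · simp
  refine { lt_top_of_isCompact := fun P hP => hcompact P hP
           toIsOpenPosMeasure := isOpenPosMeasure_of_mulLeftInvariant_of_compact
             (closure (range s.toFun)) s.bounded fun h => ?_ }
  rw [liftMeasure_apply hΓ s m s.bounded.measurableSet] at h
  have : (1 : ℝ≥0∞) ≤ 0 := by
    calc (1 : ℝ≥0∞) = ∫⁻ _, 1 ∂m := by simp
      _ ≤ _ := lintegral_mono fun x => by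
        refine le_trans ?_ (ENNReal.le_tsum (1 : Γ))
        rw [Subgroup.coe_one, mul_one, indicator_of_mem (subset_closure (mem_range_self x))]
        rfl
      _ = 0 := h
  simp at this

theorem map_mul_right_liftMeasure (hΓ : DiscreteTopology Γ) (s : BoundedBorelSection Γ)
    (m : Measure (K ⧸ Γ)) (γ : Γ) :
    (liftMeasure s m).map (· * (γ : K)) = liftMeasure s m := by
  refine Measure.ext fun A hA => ?_
  rw [Measure.map_apply (measurable_mul_const _) hA,
    liftMeasure_apply hΓ s m (measurable_mul_const _ hA), liftMeasure_apply hΓ s m hA]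
  refine lintegral_congr fun x => ?_
  rw [← (Equiv.mulRight γ).tsum_eq fun δ => A.indicator 1 (s.toFun x * δ)]
  refine tsum_congr fun δ => ?_
  rw [Equiv.coe_mulRight, Subgroup.coe_mul, ← mul_assoc]
  rfl

/-- The lifted Haar measure is right `Γ`-invariant, so the modular character is trivial on `Γ` and
determined by its values on the precompact image of `s`. It is therefore bounded, and a bounded
homomorphism to the positive reals is trivial. -/
theorem modularCharacter_eq_one (hΓ : DiscreteTopology Γ) (s : BoundedBorelSection Γ)
    (m : Measure (K ⧸ Γ)) [IsProbabilityMeasure m] [SMulInvariantMeasure K (K ⧸ Γ) m] (g : K) :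
    Measure.modularCharacter g = 1 := by
  set η := liftMeasure s m
  have : η.IsHaarMeasure := isHaarMeasure_liftMeasure hΓ s m
  obtain ⟨C, hC, hC1⟩ := exists_compact_mem_nhds (1 : K)
  have hC0 : η C ≠ 0 := (Measure.measure_pos_of_mem_nhds η hC1).ne'
  have hCt : η C ≠ ∞ := hC.measure_lt_top.ne
  have hmap : ∀ g A, MeasurableSet A → η ((· * g) ⁻¹' A) = Measure.modularCharacter g * η A :=
    fun g A hA => by
      rw [← Measure.map_apply (measurable_mul_const g) hA,
        Measure.map_right_mul_eq_modularCharacterFun_smul]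
      rfl
  have hΓ1 : ∀ γ : Γ, Measure.modularCharacter (γ : K) = 1 := fun γ => by
    have := hmap γ C hC.measurableSet
    rw [← Measure.map_apply (measurable_mul_const _) hC.measurableSet,
      map_mul_right_liftMeasure hΓ s m γ] at this
    have h := (ENNReal.mul_left_inj hC0 hCt).1 ((one_mul _).trans this)
    exact_mod_cast h.symm
  set P := (fun q : K × K => q.1 * q.2⁻¹) '' (C ×ˢ closure (range s.toFun))
  have hP : IsCompact P := (hC.prod s.bounded).image (by fun_prop)
  have hbound : ∀ g : K, (Measure.modularCharacter g : ℝ≥0∞) ≤ η P * (η C)⁻¹ := fun g => by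
    obtain ⟨γ, hγ⟩ : ∃ γ : Γ, g = s.toFun (g : K ⧸ Γ) * γ :=
      ⟨⟨(s.toFun (g : K ⧸ Γ))⁻¹ * g, QuotientGroup.eq.1 (s.mk_toFun _)⟩, by simp⟩
    rw [hγ, map_mul, hΓ1, mul_one, ← div_eq_mul_inv, ENNReal.le_div_iff_mul_le (.inl hC0) (.inl hCt),
      ← hmap _ _ hC.measurableSet]
    exact measure_mono fun k hk => ⟨(_, s.toFun g), ⟨hk, subset_closure ⟨_, rfl⟩⟩, by simp⟩
  have hle : ∀ g : K, Measure.modularCharacter g ≤ 1 := fun g => by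
    by_contra! h
    obtain ⟨n, hn⟩ := pow_unbounded_of_one_lt (η P * (η C)⁻¹).toNNReal h
    have := hbound (g ^ n)
    rw [map_pow, ← ENNReal.coe_toNNReal (a := η P * (η C)⁻¹)
      (by have := hP.measure_lt_top (μ := η); finiteness)] at this
    exact absurd (ENNReal.coe_le_coe.1 this) (not_le.2 hn)
  refine le_antisymm (hle g) ?_
  calc (1 : NNReal) = Measure.modularCharacter g⁻¹ * Measure.modularCharacter g := by
        rw [← map_mul]; simp
    _ ≤ 1 * Measure.modularCharacter g := by gcongr; exact hle _
    _ = _ := one_mul _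

end Unimodular

/-- Unimodularity passes from `G × H` to `G` by testing product Haar measure on `A ×ˢ Q` with `Q`
compact of positive measure. -/
theorem isMulRightInvariant_of_lattice_prod {G H : Type*}
    [Group G] [TopologicalSpace G] [IsTopologicalGroup G] [T2Space G] [LocallyCompactSpace G]
    [SecondCountableTopology G] [MeasurableSpace G] [BorelSpace G]
    [Group H] [TopologicalSpace H] [IsTopologicalGroup H] [T2Space H] [LocallyCompactSpace H]
    [SecondCountableTopology H] [MeasurableSpace H] [BorelSpace H]
    {Γ : Subgroup (G × H)} (hΓ : DiscreteTopology Γ) (s : BoundedBorelSection Γ)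
    (m : Measure ((G × H) ⧸ Γ)) [IsProbabilityMeasure m]
    [SMulInvariantMeasure (G × H) ((G × H) ⧸ Γ) m] (μ : Measure G) [μ.IsHaarMeasure] :
    μ.IsMulRightInvariant := by
  refine ⟨fun g => Measure.ext fun A hA => ?_⟩
  let ν : Measure H := Measure.haar
  obtain ⟨Q, hQ, hQ1⟩ := exists_compact_mem_nhds (1 : H)
  have hQ0 : ν Q ≠ 0 := (Measure.measure_pos_of_mem_nhds ν hQ1).ne'
  have hQt : ν Q ≠ ∞ := hQ.measure_lt_top.ne
  have h := Measure.map_right_mul_eq_modularCharacterFun_smul (μ.prod ν) ((g, 1) : G × H)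
  have h1 := modularCharacter_eq_one hΓ s m ((g, 1) : G × H)
  change Measure.modularCharacterFun _ = 1 at h1
  rw [h1, one_smul] at h
  have h2 := congrArg (fun η => η (A ×ˢ Q)) h
  have h3 : (fun k : G × H => k * (g, 1)) ⁻¹' (A ×ˢ Q) = ((· * g) ⁻¹' A) ×ˢ Q := by
    ext k; simp
  rw [Measure.map_apply (measurable_mul_const _) (hA.prod hQ.measurableSet), h3,
    Measure.prod_prod, Measure.prod_prod, ENNReal.mul_left_inj hQ0 hQt] at h2
  rw [Measure.map_apply (measurable_mul_const _) hA, h2]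

/-! ### From bounded `L^p`-norms to boundedness on the window -/

section BoundedOnWindow

variable {G H : Type*}
    [Group G] [TopologicalSpace G] [IsTopologicalGroup G] [T2Space G] [LocallyCompactSpace G]
    [SecondCountableTopology G] [MeasurableSpace G] [BorelSpace G]
    [Group H] [TopologicalSpace H] [IsTopologicalGroup H] [T2Space H]
    [SecondCountableTopology H] [MeasurableSpace H] [BorelSpace H]
    {X : Type*} [MeasurableSpace X] [MulAction G X] [MeasurableSMul₂ G X]
    {D : Type*} [Group D] [Countable D] {j : D →* G × H} {s : X → G × H} {β : G → X → D}

theorem measurableSet_cocycle_eq (hj : Function.Injective j) (hs : Measurable s)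
    (hβ : ∀ g x, s (g • x) * j (β g x) = (g, 1) * s x) (d : D) :
    MeasurableSet {q : X × G | β q.2 q.1 = d} := by
  have h : Measurable fun q : X × G => (s (q.2 • q.1))⁻¹ * ((q.2, 1) * s q.1) := by fun_prop
  convert h (measurableSet_singleton (j d)) using 1
  ext q
  simp only [mem_ofPred_eq, mem_preimage, mem_singleton_iff, ← hβ, inv_mul_cancel_left, hj.eq_iff]

theorem measurableSet_cocycle_mem (hj : Function.Injective j) (hs : Measurable s)
    (hβ : ∀ g x, s (g • x) * j (β g x) = (g, 1) * s x) (A : Set D) :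
    MeasurableSet {q : X × G | β q.2 q.1 ∈ A} := by
  convert MeasurableSet.biUnion A.to_countable
    fun d _ => measurableSet_cocycle_eq hj hs hβ d using 1
  ext q
  simp

/-- Chebyshev's inequality. Replacing `ε` by `δ ≤ 1` allows `δ ^ p ≤ δ`, as `p ≥ 1`. -/
theorem exists_forall_measure_norm_gt_le {m : Measure X} {ι E : Type*} [NormedAddCommGroup E]
    {p : ℝ≥0∞} (hp : 1 ≤ p) (hp' : p ≠ ∞) {f : ι → X → E} {C : ℝ≥0∞} (hC : C ≠ ∞)
    (hm : ∀ i, AEStronglyMeasurable (f i) m) (hf : ∀ i, eLpNorm (f i) p m ≤ C) {ε : ℝ≥0∞}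
    (hε : ε ≠ 0) : ∃ R : ℝ, ∀ i, m {x | R < ‖f i x‖} ≤ ε := by
  set δ := min 1 ε with hδ
  have hδ0 : δ ≠ 0 := by simp [hδ, hε]
  have hδ1 : δ ≤ 1 := min_le_left _ _
  set R : ℝ≥0∞ := C / δ + 1 with hR
  have hRt : R ≠ ∞ := by finiteness
  have hR0 : R ≠ 0 := by simp [hR]
  refine ⟨R.toReal, fun i => ?_⟩
  have hp0 : p ≠ 0 := (zero_lt_one.trans_le hp).ne'
  have hp1 : 1 ≤ p.toReal := by
    rw [← ENNReal.toReal_one]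
    exact ENNReal.toReal_mono hp' hp
  calc m {x | R.toReal < ‖f i x‖} ≤ m {x | R ≤ ‖f i x‖ₑ} := by
        refine measure_mono fun x hx => ?_
        simp only [mem_ofPred_eq] at hx ⊢
        rw [← ENNReal.ofReal_toReal hRt, ← ofReal_norm]
        exact ENNReal.ofReal_le_ofReal hx.le
    _ ≤ R⁻¹ ^ p.toReal * eLpNorm (f i) p m ^ p.toReal :=
        meas_ge_le_mul_pow_eLpNorm_enorm m hp0 hp' (hm i) hR0 (by simp [hRt])
    _ ≤ δ ^ p.toReal := by
        rw [← ENNReal.mul_rpow_of_nonneg _ _ (by positivity)]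
        refine ENNReal.rpow_le_rpow ?_ (by positivity)
        rw [mul_comm, ← div_eq_mul_inv, ENNReal.div_le_iff hR0 hRt, hR, mul_add,
          ENNReal.mul_div_cancel hδ0 (ne_top_of_le_ne_top ENNReal.one_ne_top hδ1)]
        exact (hf i).trans le_self_add
    _ ≤ δ ^ (1 : ℝ) := ENNReal.rpow_le_rpow_of_exponent_ge hδ1 hp1
    _ ≤ ε := by rw [ENNReal.rpow_one]; exact min_le_right _ _

theorem norm_map_mul_le {E : Type*} [NormedAddCommGroup E] [NormedSpace ℝ E]
    {π : D → (E ≃ₗᵢ[ℝ] E)} {b : D → E} {K : ℝ}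
    (hb : ∀ d e, ‖b (d * e) - b d - π d (b e)‖ ≤ K) (d e : D) :
    ‖b (d * e)‖ ≤ ‖b d‖ + ‖b e‖ + K := by
  calc ‖b (d * e)‖ = ‖(b (d * e) - b d - π d (b e)) + b d + π d (b e)‖ := by congr 1; abel
    _ ≤ ‖b (d * e) - b d - π d (b e)‖ + ‖b d‖ + ‖π d (b e)‖ := norm_add₃_le
    _ ≤ _ := by rw [LinearIsometryEquiv.norm_map]; linarith [hb d e]

theorem norm_map_le_inv {E : Type*} [NormedAddCommGroup E] [NormedSpace ℝ E]
    {π : D → (E ≃ₗᵢ[ℝ] E)} {b : D → E} {K : ℝ}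
    (hb : ∀ d e, ‖b (d * e) - b d - π d (b e)‖ ≤ K) (d : D) :
    ‖b d‖ ≤ ‖b d⁻¹‖ + (K + ‖b 1‖) := by
  have h := hb d d⁻¹
  rw [mul_inv_cancel] at h
  calc ‖b d‖ = ‖b 1 - (b 1 - b d - π d (b d⁻¹)) - π d (b d⁻¹)‖ := by congr 1; abel
    _ ≤ ‖b 1‖ + ‖b 1 - b d - π d (b d⁻¹)‖ + ‖π d (b d⁻¹)‖ :=
        (norm_sub_le _ _).trans (add_le_add_left (norm_sub_le _ _) _)
    _ ≤ _ := by rw [LinearIsometryEquiv.norm_map]; linarith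

theorem isBoundedOn_of_eLpNorm_le {m : Measure X} [IsProbabilityMeasure m]
    [SMulInvariantMeasure G X m] (μ : Measure G) [μ.IsHaarMeasure] [μ.IsMulRightInvariant]
    (hj : Function.Injective j) (hfin : ∀ P : Set (G × H), IsCompact P → {d | j d ∈ P}.Finite)
    (hs : Measurable s) {P : Set (G × H)} (hP : IsCompact P) (hsP : ∀ x, s x ∈ P)
    (hβ : ∀ g x, s (g • x) * j (β g x) = (g, 1) * s x)
    {W : Set H} (hW : IsCompact W) {E : Type*} [NormedAddCommGroup E] [NormedSpace ℝ E]
    {π : D → (E ≃ₗᵢ[ℝ] E)} {b : D → E} {K : ℝ}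
    (hb : ∀ d e, ‖b (d * e) - b d - π d (b e)‖ ≤ K) {p : ℝ≥0∞} (hp : 1 ≤ p) (hp' : p ≠ ∞)
    {C : ℝ≥0∞} (hC : C ≠ ∞) (hm : ∀ g, AEStronglyMeasurable (fun x => b (β g⁻¹ x)⁻¹) m)
    (hbC : ∀ g, eLpNorm (fun x => b (β g⁻¹ x)⁻¹) p m ≤ C) :
    IsBoundedOn b {d | (j d).2 ∈ W} := by
  have hb1 : 0 ≤ ‖b 1‖ := norm_nonneg _
  -- The inverse is there because the induced cocycle evaluates `b` at `(β g⁻¹ x)⁻¹`.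
  obtain ⟨R, hR⟩ := quasiLength_bounded_of_cocycle (m := m) μ hj hfin hs hP hsP hβ hW
    (N := fun d => ‖b d⁻¹‖) (c := K + ‖b 1‖)
    (fun d e => by
      rw [mul_inv_rev]
      linarith [norm_map_mul_le hb e⁻¹ d⁻¹])
    (fun d => by
      rw [inv_inv]
      exact norm_map_le_inv hb d)
    (fun R => measurableSet_cocycle_mem hj hs hβ {d | R < ‖b d⁻¹‖})
    (fun ε hε => by
      obtain ⟨R, hR⟩ := exists_forall_measure_norm_gt_le hp hp' hC hm hbC hε
      refine ⟨R, fun g => ?_⟩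
      simpa using hR g⁻¹)
  exact ⟨R + (K + ‖b 1‖), fun d hd => (norm_map_le_inv hb d).trans (by linarith [hR d hd])⟩

end BoundedOnWindow

/-! ### The action of `G` on the coset space, and part (1) -/

section CosetAction

variable {G H : Type*}
    [Group G] [TopologicalSpace G] [IsTopologicalGroup G] [T2Space G] [LocallyCompactSpace G]
    [SecondCountableTopology G] [MeasurableSpace G] [BorelSpace G]
    [Group H] [TopologicalSpace H] [IsTopologicalGroup H] [T2Space H] [LocallyCompactSpace H]
    [SecondCountableTopology H] [MeasurableSpace H] [BorelSpace H] {Γ : Subgroup (G × H)}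

/-- The action of the first factor `G` on `(G × H) ⧸ Γ`. -/
abbrev fstAction (Γ : Subgroup (G × H)) : MulAction G ((G × H) ⧸ Γ) :=
  MulAction.compHom _ (MonoidHom.inl G H)

theorem measurableSMul₂_fstAction (hΓ : DiscreteTopology Γ) :
    letI := fstAction Γ
    MeasurableSMul₂ G ((G × H) ⧸ Γ) := by
  let := fstAction Γ
  have := borelSpace_coset Γ hΓ
  have : Continuous fun q : G × ((G × H) ⧸ Γ) => ((q.1, 1) : G × H) • q.2 := by fun_prop
  exact ⟨this.measurable⟩

theorem smulInvariantMeasure_fstAction (m : Measure ((G × H) ⧸ Γ))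
    [SMulInvariantMeasure (G × H) ((G × H) ⧸ Γ) m] :
    letI := fstAction Γ
    SMulInvariantMeasure G ((G × H) ⧸ Γ) m :=
  letI := fstAction Γ
  ⟨fun g _ hA => SMulInvariantMeasure.measure_preimage_smul ((g, 1) : G × H) hA⟩

theorem isBoundedOn_windowSet (hΓ : DiscreteTopology Γ) {W : Set H} (hW : IsCompact W)
    {p : ℝ≥0∞} [hp : Fact (1 ≤ p)] (hp' : p < ∞) {E : Type*} [NormedAddCommGroup E]
    [NormedSpace ℝ E] {π : Γ → (E ≃ₗᵢ[ℝ] E)} {b : Γ → E} (hb : IsWQPair p π b)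
    (m : Measure ((G × H) ⧸ Γ)) [IsProbabilityMeasure m]
    [SMulInvariantMeasure (G × H) ((G × H) ⧸ Γ) m] (s : BoundedBorelSection Γ)
    (hbdd : IsBoundedOn (inducedPair hΓ s m p (π, b)).2 (univ ×ˢ {1})) :
    IsBoundedOn b (windowSet Γ W) := by
  have : Countable Γ := countable_of_Lindelof_of_discrete
  let := fstAction Γ
  have := measurableSMul₂_fstAction hΓ
  have := smulInvariantMeasure_fstAction m
  have := isMulRightInvariant_of_lattice_prod hΓ s m (Measure.haar : Measure G)
  obtain ⟨K, hK⟩ := hb.bounded_defect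
  obtain ⟨C, hC⟩ := hbdd
  have hmem := fun g : G => memLp_inducedCocycle hΓ s m p b ((g, 1) : G × H)
  have hinv : ∀ g : G, ((g⁻¹, 1) : G × H) = (g, 1)⁻¹ := fun g => by simp
  refine isBoundedOn_of_eLpNorm_le (m := m) (Measure.haar : Measure G) (j := Γ.subtype)
    (β := fun g => s.beta (g, 1)) Γ.subtype_injective
    (fun P hP => finite_mem_of_isCompact hΓ hP) s.measurable_toFun s.bounded
    (fun x => subset_closure (mem_range_self x)) (fun g x => s.mul_beta (g, 1) x) hW hK hp.out hp'.ne
    (C := ENNReal.ofReal C) (by finiteness)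
    (fun g => by rw [hinv]; exact (hmem g).1) (fun g => ?_)
  rw [hinv]
  have h := hC (g, 1) ⟨mem_univ _, rfl⟩
  change ‖(hmem g).toLp _‖ ≤ C at h
  rw [Lp.norm_toLp] at h
  exact (ENNReal.le_ofReal_iff_toReal_le (hmem g).2.ne ((norm_nonneg _).trans (hC (1, 1) (by simp)))).2 h

end CosetAction

/-! ### `L^p(X; E)` is an `L^p`-space if `E` is one -/

section LpValued

theorem enorm_rpow_eq_lintegral {Z F : Type*} [MeasurableSpace Z] [NormedAddCommGroup F]
    {ν : Measure Z} {p : ℝ≥0∞} (hp : 1 ≤ p) (hp' : p ≠ ∞) {v : Lp F p ν} {f : Z → F}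
    (hf : v =ᵐ[ν] f) : ‖v‖ₑ ^ p.toReal = ∫⁻ z, ‖f z‖ₑ ^ p.toReal ∂ν := by
  have hp0 : p ≠ 0 := (zero_lt_one.trans_le hp).ne'
  have hp1 : p.toReal ≠ 0 := (ENNReal.toReal_pos hp0 hp').ne'
  rw [Lp.enorm_def, eLpNorm_congr_ae hf, eLpNorm_eq_lintegral_rpow_enorm_toReal hp0 hp', ← ENNReal.rpow_mul,
    one_div, inv_mul_cancel₀ hp1, ENNReal.rpow_one]

/-- In a separable space balls generate the Borel σ-algebra, so measurability of all distance
functions is enough. For `L^p` these are integrals, which Tonelli's theorem controls. -/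
theorem measurable_of_measurable_enorm_sub {T V : Type*} [MeasurableSpace T]
    [NormedAddCommGroup V] [SecondCountableTopology V] [MeasurableSpace V] [BorelSpace V]
    {Φ : T → V} (h : ∀ v, Measurable fun t => ‖Φ t - v‖ₑ) : Measurable Φ := by
  have hb : TopologicalSpace.IsTopologicalBasis {B : Set V | ∃ v r, B = Metric.eball v r} := by
    refine TopologicalSpace.isTopologicalBasis_of_isOpen_of_nhds ?_ fun v U hv hU => ?_
    · rintro _ ⟨v, r, rfl⟩
      exact Metric.isOpen_eball
    · obtain ⟨r, hr, hrU⟩ := EMetric.isOpen_iff.1 hU v hv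
      exact ⟨_, ⟨v, r, rfl⟩, Metric.mem_eball_self hr, hrU⟩
  rw [BorelSpace.measurable_eq (α := V), hb.borel_eq_generateFrom]
  refine measurable_generateFrom ?_
  rintro _ ⟨v, r, rfl⟩
  have : Φ ⁻¹' Metric.eball v r = (fun t => ‖Φ t - v‖ₑ) ⁻¹' Iio r := by
    ext t
    simp [edist_eq_enorm_sub]
  rw [this]
  exact h v measurableSet_Iio

/-- A family of elements of `L^p` with jointly measurable representatives is measurable. -/
theorem measurable_toLp_of_uncurry {T Z F : Type*} [MeasurableSpace T] [MeasurableSpace Z]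
    [NormedAddCommGroup F] [SecondCountableTopology F] [MeasurableSpace F] [BorelSpace F]
    {ν : Measure Z} [SFinite ν] {p : ℝ≥0∞} [hp : Fact (1 ≤ p)] (hp' : p ≠ ∞)
    [SecondCountableTopology (Lp F p ν)] [MeasurableSpace (Lp F p ν)] [BorelSpace (Lp F p ν)]
    {Φ : T → Lp F p ν} {φ : T × Z → F} (hφ : Measurable φ)
    (h : ∀ t, Φ t =ᵐ[ν] fun z => φ (t, z)) : Measurable Φ := by
  have hp0 : p ≠ 0 := (zero_lt_one.trans_le hp.out).ne'
  have hp1 : p.toReal ≠ 0 := (ENNReal.toReal_pos hp0 hp').ne'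
  refine measurable_of_measurable_enorm_sub fun v => ?_
  have e : ∀ t, ‖Φ t - v‖ₑ = (∫⁻ z, ‖φ (t, z) - v z‖ₑ ^ p.toReal ∂ν) ^ (p.toReal)⁻¹ := fun t => by
    rw [← enorm_rpow_eq_lintegral hp.out hp' (v := Φ t - v), ← ENNReal.rpow_mul,
      mul_inv_cancel₀ hp1, ENNReal.rpow_one]
    filter_upwards [Lp.coeFn_sub (Φ t) v, h t] with z h1 h2
    rw [h1, Pi.sub_apply, h2]
  simp only [e]
  have hv : Measurable v := (Lp.stronglyMeasurable v).measurable
  fun_prop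

variable {X Z : Type*} [MeasurableSpace X] [MeasurableSpace Z] {m : Measure X} {μ : Measure Z}
  [SFinite m] [SFinite μ] {p : ℝ≥0∞} [hp : Fact (1 ≤ p)] {E : Type*} [NormedAddCommGroup E]
  [NormedSpace ℝ E]

/-- The function `u` with values in `E ≅ L^p(Z)` corresponds to the function `f` on `X × Z`. -/
def IsUncurried (J : E ≃ₗᵢ[ℝ] Lp ℝ p μ) (f : X × Z → ℝ) (u : X → E) : Prop :=
  ∀ᵐ x ∂m, J (u x) =ᵐ[μ] fun z => f (x, z)

theorem IsUncurried.norm_eq (hp' : p ≠ ∞) {J : E ≃ₗᵢ[ℝ] Lp ℝ p μ} {f : Lp ℝ p (m.prod μ)}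
    {u : Lp E p m} (h : IsUncurried (m := m) J f u) : ‖u‖ = ‖f‖ := by
  have hp0 : p ≠ 0 := (zero_lt_one.trans_le hp.out).ne'
  have hp1 : p.toReal ≠ 0 := (ENNReal.toReal_pos hp0 hp').ne'
  have hf : Measurable f := (Lp.stronglyMeasurable f).measurable
  have e : ‖u‖ₑ ^ p.toReal = ‖f‖ₑ ^ p.toReal := by
    rw [enorm_rpow_eq_lintegral hp.out hp' (v := u) .rfl,
      enorm_rpow_eq_lintegral hp.out hp' (v := f) .rfl, lintegral_prod _ (by fun_prop)]
    refine lintegral_congr_ae ?_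
    filter_upwards [h] with x hx
    rw [← enorm_rpow_eq_lintegral hp.out hp' hx, LinearIsometryEquiv.enorm_map]
  have := ENNReal.rpow_left_injective hp1 e
  simpa [enorm_eq_iff_norm_eq] using this

theorem exists_isUncurried (hp' : p ≠ ∞) [SecondCountableTopology (Lp ℝ p μ)]
    (J : E ≃ₗᵢ[ℝ] Lp ℝ p μ) (f : Lp ℝ p (m.prod μ)) :
    ∃ u : Lp E p m, IsUncurried (m := m) J f u := by
  have hp0 : p ≠ 0 := (zero_lt_one.trans_le hp.out).ne'
  have hp1 : 0 < p.toReal := ENNReal.toReal_pos hp0 hp'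
  have hf : Measurable f := (Lp.stronglyMeasurable f).measurable
  set I : X → ℝ≥0∞ := fun x => ∫⁻ z, ‖f (x, z)‖ₑ ^ p.toReal ∂μ with hI
  have hIm : Measurable I := by fun_prop
  have hIf : ∫⁻ x, I x ∂m = ‖f‖ₑ ^ p.toReal := by
    rw [enorm_rpow_eq_lintegral hp.out hp' (v := f) .rfl, lintegral_prod _ (by fun_prop)]
  have hIt : ∫⁻ x, I x ∂m ≠ ∞ := by
    rw [hIf]
    exact ENNReal.rpow_ne_top_of_nonneg hp1.le (by simp)
  -- Only almost every slice of `f` is in `L^p`; the exceptional slices are replaced by zero so that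
  -- every slice defines an element of `L^p`.
  set φ : X × Z → ℝ := fun q => {x | I x ≠ ∞}.indicator (fun _ => f q) q.1 with hφ
  have hφm : Measurable φ := by
    have : φ = (Prod.fst ⁻¹' {x | I x ≠ ∞}).indicator f := by
      ext q
      simp [hφ, indicator]
    rw [this]
    exact hf.indicator (measurable_fst (hIm (measurableSet_singleton ∞).compl))
  have hmem : ∀ x, MemLp (fun z => φ (x, z)) p μ := fun x => by
    by_cases hx : I x = ∞
    · have : (fun z => φ (x, z)) = 0 := by ext z; simp [hφ, hx]
      rw [this]
      exact MemLp.zero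
    · have : (fun z => φ (x, z)) = fun z => f (x, z) := by ext z; simp [hφ, hx]
      rw [this]
      refine ⟨(hf.comp measurable_prodMk_left).aestronglyMeasurable, ?_⟩
      exact (eLpNorm_lt_top_iff_lintegral_rpow_enorm_lt_top hp0 hp').2 (lt_top_iff_ne_top.2 hx)
  borelize ↥(Lp ℝ p μ)
  have hmeas : Measurable fun x => (hmem x).toLp _ :=
    measurable_toLp_of_uncurry hp' hφm fun x => (hmem x).coeFn_toLp
  set v : X → E := fun x => J.symm ((hmem x).toLp _) with hv
  have hvm : AEStronglyMeasurable v m :=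
    J.symm.continuous.comp_aestronglyMeasurable hmeas.aestronglyMeasurable
  have hvI : ∀ᵐ x ∂m, J (v x) =ᵐ[μ] fun z => f (x, z) := by
    filter_upwards [ae_lt_top hIm hIt] with x hx
    rw [hv, LinearIsometryEquiv.apply_symm_apply]
    refine (hmem x).coeFn_toLp.trans (.of_forall fun z => ?_)
    simp [hφ, hx.ne]
  have hvmem : MemLp v p m := by
    refine ⟨hvm, (eLpNorm_lt_top_iff_lintegral_rpow_enorm_lt_top hp0 hp').2 ?_⟩
    rw [lintegral_congr_ae (g := I) ?_]
    · exact lt_top_iff_ne_top.2 hIt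
    · filter_upwards [hvI] with x hx
      rw [← LinearIsometryEquiv.enorm_map J, enorm_rpow_eq_lintegral hp.out hp' hx]
  refine ⟨hvmem.toLp v, ?_⟩
  filter_upwards [hvmem.coeFn_toLp, hvI] with x h1 h2
  rw [h1]
  exact h2

theorem IsUncurried.add {J : E ≃ₗᵢ[ℝ] Lp ℝ p μ} {f f' : Lp ℝ p (m.prod μ)} {u u' : Lp E p m}
    (h : IsUncurried (m := m) J f u) (h' : IsUncurried (m := m) J f' u') :
    IsUncurried (m := m) J (f + f' : Lp ℝ p (m.prod μ)) (u + u' : Lp E p m) := by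
  filter_upwards [h, h', Lp.coeFn_add u u', Measure.ae_ae_of_ae_prod (Lp.coeFn_add f f')]
    with x h1 h2 h3 h4
  rw [h3, Pi.add_apply, map_add]
  filter_upwards [h1, h2, h4, Lp.coeFn_add (J (u x)) (J (u' x))] with z h1 h2 h4 h5
  rw [h5, h4, Pi.add_apply, Pi.add_apply, h1, h2]

theorem IsUncurried.smul {J : E ≃ₗᵢ[ℝ] Lp ℝ p μ} {f : Lp ℝ p (m.prod μ)} {u : Lp E p m} (c : ℝ)
    (h : IsUncurried (m := m) J f u) :
    IsUncurried (m := m) J (c • f : Lp ℝ p (m.prod μ)) (c • u : Lp E p m) := by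
  filter_upwards [h, Lp.coeFn_smul c u, Measure.ae_ae_of_ae_prod (Lp.coeFn_smul c f)]
    with x h1 h3 h4
  rw [h3, Pi.smul_apply, map_smul]
  filter_upwards [h1, h4, Lp.coeFn_smul c (J (u x))] with z h1 h4 h5
  rw [h5, h4, Pi.smul_apply, Pi.smul_apply, h1]

theorem IsUncurried.unique (hp' : p ≠ ∞) {J : E ≃ₗᵢ[ℝ] Lp ℝ p μ} {f : Lp ℝ p (m.prod μ)}
    {u u' : Lp E p m} (h : IsUncurried (m := m) J f u) (h' : IsUncurried (m := m) J f u') :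
    u = u' := by
  have := (h.add (h'.smul (-1))).norm_eq hp'
  rw [neg_one_smul, neg_one_smul, add_neg_cancel, norm_zero, norm_eq_zero] at this
  exact add_neg_eq_zero.1 this

/-- The isometric embedding `L^p(X × Z) → L^p(X; E)` for `E ≅ L^p(Z)`. -/
noncomputable def curryLp (hp' : p ≠ ∞) [SecondCountableTopology (Lp ℝ p μ)]
    (J : E ≃ₗᵢ[ℝ] Lp ℝ p μ) : Lp ℝ p (m.prod μ) →ₗᵢ[ℝ] Lp E p m where
  toFun f := (exists_isUncurried hp' J f).choose
  map_add' f f' := IsUncurried.unique hp' (exists_isUncurried hp' J _).choose_spec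
    ((exists_isUncurried hp' J f).choose_spec.add (exists_isUncurried hp' J f').choose_spec)
  map_smul' c f := IsUncurried.unique hp' (exists_isUncurried hp' J _).choose_spec
    ((exists_isUncurried hp' J f).choose_spec.smul c)
  norm_map' f := (exists_isUncurried hp' J f).choose_spec.norm_eq hp'

/-- The range of an isometry from a complete space is closed, and it contains the functions `1_s ·
c`, the images of `(x, z) ↦ 1_s(x) J c (z)`, whose sums are dense. -/
theorem curryLp_surjective (hp' : p ≠ ∞) [SecondCountableTopology (Lp ℝ p μ)]
    (J : E ≃ₗᵢ[ℝ] Lp ℝ p μ) : Function.Surjective (curryLp (m := m) hp' J) := by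
  have hp0 : p ≠ 0 := (zero_lt_one.trans_le hp.out).ne'
  have hp1 : 0 < p.toReal := ENNReal.toReal_pos hp0 hp'
  intro u
  refine Lp.induction hp' (fun u => ∃ f, curryLp (m := m) hp' J f = u) (fun c s hs hms => ?_) ?_ ?_ u
  · have hc : Measurable (J c) := (Lp.stronglyMeasurable (J c)).measurable
    set φ : X × Z → ℝ := (s ×ˢ univ).indicator fun q => J c q.2 with hφ
    have hφm : Measurable φ := (hc.comp measurable_snd).indicator (hs.prod .univ)
    have hmem : MemLp φ p (m.prod μ) := by
      refine ⟨hφm.aestronglyMeasurable,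
        (eLpNorm_lt_top_iff_lintegral_rpow_enorm_lt_top hp0 hp').2 ?_⟩
      rw [lintegral_prod _ (by fun_prop)]
      calc _ = ∫⁻ x, s.indicator (fun _ => ‖J c‖ₑ ^ p.toReal) x ∂m := by
            refine lintegral_congr fun x => ?_
            rw [enorm_rpow_eq_lintegral hp.out hp' (v := J c) .rfl]
            by_cases hx : x ∈ s <;> simp [hφ, indicator, hx, hp1]
        _ < ∞ := by
            rw [lintegral_indicator_const hs]
            exact ENNReal.mul_lt_top (ENNReal.rpow_lt_top_of_nonneg hp1.le (by simp)) hms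
    refine ⟨hmem.toLp φ, IsUncurried.unique hp' (exists_isUncurried hp' J _).choose_spec ?_⟩
    filter_upwards [Measure.ae_ae_of_ae_prod hmem.coeFn_toLp,
      indicatorConstLp_coeFn (p := p) (hs := hs) (hμs := hms.ne) (c := c)] with x h1 h2
    rw [Lp.simpleFunc.coe_indicatorConst, h2]
    by_cases hx : x ∈ s
    · filter_upwards [h1] with z hz
      rw [hz]
      simp [hφ, hx]
    · rw [indicator_of_notMem hx, map_zero]
      filter_upwards [h1, Lp.coeFn_zero ℝ p μ] with z hz h0
      rw [hz, h0]
      simp [hφ, hx]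
  · rintro f g hf hg - ⟨f', hf'⟩ ⟨g', hg'⟩
    exact ⟨f' + g', by rw [map_add, hf', hg']⟩
  · exact (curryLp (m := m) hp' J).isometry.isClosedEmbedding.isClosed_range

theorem isLpSpace_Lp {X : Type} [MeasurableSpace X] [StandardBorelSpace X] (m : Measure X)
    [SigmaFinite m] (hp' : p ≠ ∞) (hE : IsLpSpace p E) : IsLpSpace p (Lp E p m) := by
  obtain ⟨Z, _, _, μ, _, ⟨J⟩⟩ := hE
  have : Fact (p ≠ ∞) := ⟨hp'⟩
  exact ⟨X × Z, inferInstance, inferInstance, m.prod μ, inferInstance,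
    ⟨(LinearIsometryEquiv.ofSurjective (curryLp hp' J) (curryLp_surjective hp' J)).symm⟩⟩

theorem IsLpSpace.secondCountableTopology (hp' : p ≠ ∞) (hE : IsLpSpace p E) :
    SecondCountableTopology E := by
  obtain ⟨Z, _, _, μ, _, ⟨J⟩⟩ := hE
  have : Fact (p ≠ ∞) := ⟨hp'⟩
  exact J.toHomeomorph.secondCountableTopology

end LpValued

/-! ### Automatic continuity of measurable affine actions -/

section Steinhaus

variable {G : Type*} [Group G] [TopologicalSpace G] [IsTopologicalGroup G] [T2Space G]
    [LocallyCompactSpace G] [SecondCountableTopology G] [MeasurableSpace G] [BorelSpace G]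

/-- Countably many balls of radius `ε / 2` cover `V`, so one preimage has positive Haar measure and
its quotients fill a neighbourhood of `1`. The equivariance `h` carries continuity at `1` to every
point. -/
theorem continuous_of_measurable_of_dist_mul {V : Type*} [PseudoMetricSpace V]
    [SecondCountableTopology V] [MeasurableSpace V] [BorelSpace V] {f : G → V} (hf : Measurable f)
    (h : ∀ a g, dist (f (a * g)) (f a) = dist (f g) (f 1)) : Continuous f := by
  have h1 : Filter.Tendsto (fun g => dist (f g) (f 1)) (nhds 1) (nhds 0) := by
    rw [Metric.tendsto_nhds]
    intro ε hε
    let μ : Measure G := Measure.haar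
    have hne : Nonempty V := ⟨f 1⟩
    -- The preimage is inverted since quotients `a * b⁻¹` of the inverted set are the left quotients
    -- needed in `h`.
    obtain ⟨n, hn⟩ : ∃ n, 0 < μ ((f ⁻¹' Metric.ball (TopologicalSpace.denseSeq V n) (ε / 2))⁻¹) := by
      by_contra! H
      have : μ (⋃ n, (f ⁻¹' Metric.ball (TopologicalSpace.denseSeq V n) (ε / 2))⁻¹) = 0 :=
        measure_iUnion_null fun n => le_antisymm (H n) bot_le
      have hU : ⋃ n, (f ⁻¹' Metric.ball (TopologicalSpace.denseSeq V n) (ε / 2))⁻¹ = univ := by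
        refine eq_univ_of_forall fun g => ?_
        obtain ⟨n, hn⟩ := (TopologicalSpace.denseRange_denseSeq V).exists_dist_lt (f g⁻¹)
          (half_pos hε)
        exact mem_iUnion.2 ⟨n, hn⟩
      rw [hU] at this
      exact (NeZero.ne μ) (Measure.measure_univ_eq_zero.1 this)
    have hE := Measure.div_mem_nhds_one_of_haar_pos μ _
      (hf Metric.isOpen_ball.measurableSet).inv hn
    filter_upwards [hE] with g hg
    obtain ⟨a, ha, b, hb, rfl⟩ := Set.mem_div.1 hg
    rw [Set.mem_inv, mem_preimage, Metric.mem_ball] at ha hb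
    have hd := h a⁻¹ (a / b)
    rw [div_eq_mul_inv, inv_mul_cancel_left] at hd
    rw [Real.dist_0_eq_abs, abs_of_nonneg dist_nonneg, div_eq_mul_inv, ← hd]
    linarith [dist_triangle_right (f b⁻¹) (f a⁻¹) (TopologicalSpace.denseSeq V n)]
  refine continuous_iff_continuousAt.2 fun a => ?_
  rw [ContinuousAt, tendsto_iff_dist_tendsto_zero]
  have h2 : Filter.Tendsto (fun g => a⁻¹ * g) (nhds a) (nhds 1) := by
    have : Continuous fun g => a⁻¹ * g := by fun_prop
    simpa using this.tendsto a
  refine (h1.comp h2).congr fun g => ?_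
  rw [Function.comp_apply, ← h a, mul_inv_cancel_left]

/-- A measurable affine action on a separable `L^p`-space is continuous. -/
theorem isAffineAction_of_measurable {p : ℝ≥0∞} [Fact (1 ≤ p)] {V : Type*} [NormedAddCommGroup V]
    [NormedSpace ℝ V] [SecondCountableTopology V] [MeasurableSpace V] [BorelSpace V]
    (hV : IsLpSpace p V) {ρ : G → (V ≃ₗᵢ[ℝ] V)} {c : G → V} (hρ : ∀ v, Measurable fun g => ρ g v)
    (hc : Measurable c) (hmul : ∀ g h, ρ (g * h) = ρ g * ρ h)
    (hcoc : ∀ g h, c (g * h) = c g + ρ g (c h)) : IsAffineAction p ρ c where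
  isLpSpace := hV
  map_mul := hmul
  continuous_rep v := continuous_of_measurable_of_dist_mul (hρ v) fun a g => by
    have h1 : ρ a v = ρ a (ρ 1 v) := by
      conv_lhs => rw [← mul_one a, hmul]
      rfl
    rw [hmul, h1]
    exact (ρ a).dist_map _ _
  cocycle := hcoc
  continuous_cocycle := continuous_of_measurable_of_dist_mul hc fun a g => by
    have h1 : ρ 1 = 1 := by
      have := hmul 1 1
      rwa [mul_one, left_eq_mul] at this
    have h2 : c 1 = 0 := by
      have := hcoc 1 1
      rw [mul_one, h1] at this
      exact left_eq_add.1 this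
    rw [hcoc a g, h2, dist_eq_norm, add_sub_cancel_left, dist_zero_right,
      LinearIsometryEquiv.norm_map]

end Steinhaus

/-! ### The Borel structure of the strong operator topology -/

section StrongOperator

variable {V : Type*} [NormedAddCommGroup V] [NormedSpace ℝ V]

/-- Isometries are equicontinuous, so evaluations on a dense sequence determine the topology. It is
thus induced from a countable product, whose Borel σ-algebra is the product one when `V` is
separable. -/
theorem strongOperatorTopology_eq_induced {u : ℕ → V} (hu : DenseRange u) :
    strongOperatorTopology V =
      TopologicalSpace.induced (fun (T : V ≃ₗᵢ[ℝ] V) n => T (u n)) inferInstance := by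
  refine le_antisymm ?_ ?_
  · rw [← continuous_iff_le_induced]
    let := strongOperatorTopology V
    have : Continuous fun (T : V ≃ₗᵢ[ℝ] V) (v : V) => T v := continuous_induced_dom
    exact continuous_pi fun n => (continuous_apply (u n)).comp this
  · rw [strongOperatorTopology, ← continuous_iff_le_induced]
    let := TopologicalSpace.induced (fun (T : V ≃ₗᵢ[ℝ] V) n => T (u n)) inferInstance
    have : Continuous fun (T : V ≃ₗᵢ[ℝ] V) n => T (u n) := continuous_induced_dom
    refine continuous_pi fun v => continuous_of_uniform_approx_of_continuous fun U hU => ?_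
    obtain ⟨ε, hε, hεU⟩ := Metric.mem_uniformity_dist.1 hU
    obtain ⟨n, hn⟩ := hu.exists_dist_lt v hε
    exact ⟨fun T => T (u n), (continuous_apply n).comp this,
      fun T => hεU (by rwa [LinearIsometryEquiv.dist_map])⟩

theorem measurable_strongOperator [SecondCountableTopology V] [MeasurableSpace V] [BorelSpace V]
    {T : Type*} [MeasurableSpace T] {f : T → (V ≃ₗᵢ[ℝ] V)} (hf : ∀ v, Measurable fun t => f t v) :
    @Measurable _ _ _ (@borel _ (strongOperatorTopology V)) f := by
  rw [strongOperatorTopology_eq_induced (TopologicalSpace.denseRange_denseSeq V), borel_comap,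
    ← BorelSpace.measurable_eq, measurable_comap_iff]
  exact measurable_pi_lambda _ fun n => hf _

end StrongOperator

/-! ### Inducing pairs to `G` along a cocycle with values in a countable group -/

section InducedPair

variable {G : Type*} [Group G] [TopologicalSpace G] [IsTopologicalGroup G] [T2Space G]
    [LocallyCompactSpace G] [SecondCountableTopology G] [MeasurableSpace G] [BorelSpace G]
    {X : Type*} [MeasurableSpace X] [MulAction G X] [MeasurableSMul₂ G X]
    {D : Type*} [Group D] [Countable D] [MeasurableSpace D] [DiscreteMeasurableSpace D]
    {β : G → X → D} {E : Type*} [NormedAddCommGroup E] [NormedSpace ℝ E] {p : ℝ≥0∞}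
    [hp : Fact (1 ≤ p)]

theorem measurable_cocycle_inv (hβ : Measurable fun q : X × G => β q.2 q.1) (g : G) :
    Measurable fun x => (β g⁻¹ x)⁻¹ :=
  Measurable.of_discrete.comp (hβ.comp (measurable_id.prodMk (measurable_const (a := g⁻¹))))

/-- The isometry `f ↦ (x ↦ f (g⁻¹ x))` of `L^p(X; E)`. -/
noncomputable def koopmanIsometry (m : Measure X) [SMulInvariantMeasure G X m] (p : ℝ≥0∞)
    [Fact (1 ≤ p)] (E : Type*) [NormedAddCommGroup E] [NormedSpace ℝ E] (g : G) :
    Lp E p m ≃ₗᵢ[ℝ] Lp E p m :=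
  LinearIsometryEquiv.ofSurjective
    (Lp.compMeasurePreservingₗᵢ ℝ _ (measurePreserving_smul g⁻¹ m)) fun f => by
      refine ⟨Lp.compMeasurePreserving _ (measurePreserving_smul g m) f, ?_⟩
      ext1
      refine (Lp.coeFn_compMeasurePreserving _ (measurePreserving_smul g⁻¹ m)).trans ?_
      filter_upwards [(measurePreserving_smul g⁻¹ m).quasiMeasurePreserving.ae
        (Lp.coeFn_compMeasurePreserving f (measurePreserving_smul g m))] with x hx
      rw [Function.comp_apply, hx, Function.comp_apply, smul_inv_smul]

/-- The map `G → O(L^p(X; E))` induced from `π : D → O(E)` by means of the cocycle `β`. -/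
noncomputable def cocycleRep (m : Measure X) [SMulInvariantMeasure G X m] (p : ℝ≥0∞)
    [Fact (1 ≤ p)] (hβ : Measurable fun q : X × G => β q.2 q.1) (π : D → (E ≃ₗᵢ[ℝ] E)) (g : G) :
    Lp E p m ≃ₗᵢ[ℝ] Lp E p m :=
  (koopmanIsometry m p E g).trans (fiberwiseIsometry m p (measurable_cocycle_inv hβ g) π)

variable {m : Measure X} [SMulInvariantMeasure G X m]

theorem cocycleRep_apply (hβ : Measurable fun q : X × G => β q.2 q.1) (π : D → (E ≃ₗᵢ[ℝ] E))
    (g : G) (f : Lp E p m) :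
    cocycleRep m p hβ π g f =ᵐ[m] fun x => π (β g⁻¹ x)⁻¹ (f (g⁻¹ • x)) := by
  filter_upwards [(memLp_fiberwise (measurable_cocycle_inv hβ g) π
      (koopmanIsometry m p E g f)).coeFn_toLp,
    Lp.coeFn_compMeasurePreserving f (measurePreserving_smul g⁻¹ m)] with x hx₁ hx₂
  exact hx₁.trans (congrArg _ hx₂)

theorem memLp_cocycle [IsFiniteMeasure m] (hβ : Measurable fun q : X × G => β q.2 q.1)
    (hfin : ∀ g, (range (β g)).Finite) (b : D → E) (g : G) :
    MemLp (fun x => b (β g⁻¹ x)⁻¹) p m := by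
  have hfin' : (range fun x => ‖b (β g⁻¹ x)⁻¹‖).Finite := by
    have := (hfin g⁻¹).image fun d => ‖b d⁻¹‖
    rwa [← range_comp] at this
  obtain ⟨C, hC⟩ := hfin'.bddAbove
  refine MemLp.of_bound ?_ C (Filter.Eventually.of_forall fun x => hC ⟨x, rfl⟩)
  exact ((StronglyMeasurable.of_discrete (f := b)).comp_measurable
    (measurable_cocycle_inv hβ g)).aestronglyMeasurable

variable [IsProbabilityMeasure m]

theorem Lp.norm_le_of_ae_le {f : Lp E p m} {C : ℝ} (hC : 0 ≤ C) (h : ∀ᵐ x ∂m, ‖f x‖ ≤ C) :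
    ‖f‖ ≤ C := by
  have := Lp.norm_le_of_ae_bound hC h
  simpa [measureUnivNNReal] using this

theorem measurable_cocycleRep (hp' : p ≠ ∞) [SecondCountableTopology E]
    [SecondCountableTopology (Lp E p m)] [MeasurableSpace (Lp E p m)] [BorelSpace (Lp E p m)]
    (hβ : Measurable fun q : X × G => β q.2 q.1) (π : D → (E ≃ₗᵢ[ℝ] E)) (f : Lp E p m) :
    Measurable fun g => cocycleRep m p hβ π g f := by
  borelize E
  have h1 : Measurable fun q : D × E => π q.1 q.2 :=
    measurable_from_prod_countable_right fun d => (π d).continuous.measurable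
  have h2 : Measurable f := (Lp.stronglyMeasurable f).measurable
  have h3 : Measurable fun q : G × X => (β q.1⁻¹ q.2)⁻¹ :=
    Measurable.of_discrete.comp (hβ.comp (by fun_prop : Measurable fun q : G × X => (q.2, q.1⁻¹)))
  exact measurable_toLp_of_uncurry hp'
    (φ := fun q : G × X => π (β q.1⁻¹ q.2)⁻¹ (f (q.1⁻¹ • q.2)))
    (h1.comp (h3.prodMk (h2.comp (by fun_prop)))) (cocycleRep_apply hβ π · f)

theorem measurable_cocycle_toLp (hp' : p ≠ ∞) [SecondCountableTopology E]
    [SecondCountableTopology (Lp E p m)] [MeasurableSpace (Lp E p m)] [BorelSpace (Lp E p m)]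
    (hβ : Measurable fun q : X × G => β q.2 q.1) (hfin : ∀ g, (range (β g)).Finite) (b : D → E) :
    Measurable fun g => ((memLp_cocycle hβ hfin b g).toLp _ : Lp E p m) := by
  borelize E
  have h3 : Measurable fun q : G × X => (β q.1⁻¹ q.2)⁻¹ :=
    Measurable.of_discrete.comp (hβ.comp (by fun_prop : Measurable fun q : G × X => (q.2, q.1⁻¹)))
  exact measurable_toLp_of_uncurry hp' (φ := fun q : G × X => b (β q.1⁻¹ q.2)⁻¹)
    (Measurable.of_discrete.comp h3) fun g => (memLp_cocycle hβ hfin b g).coeFn_toLp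

theorem cocycle_inv_mul (hcoc : ∀ g h x, β (g * h) x = β g (h • x) * β h x) (g h : G) (x : X) :
    (β (g * h)⁻¹ x)⁻¹ = (β g⁻¹ x)⁻¹ * (β h⁻¹ (g⁻¹ • x))⁻¹ := by
  rw [mul_inv_rev, hcoc, mul_inv_rev]

theorem cocycleRep_mul (hβ : Measurable fun q : X × G => β q.2 q.1)
    (hcoc : ∀ g h x, β (g * h) x = β g (h • x) * β h x) {π : D → (E ≃ₗᵢ[ℝ] E)} (hπ : ∀ d e, π (d * e) = π d * π e) (g h : G) :
    cocycleRep m p hβ π (g * h) = cocycleRep m p hβ π g * cocycleRep m p hβ π h := by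
  ext1 f
  ext1
  change _ =ᵐ[m] cocycleRep m p hβ π g (cocycleRep m p hβ π h f)
  filter_upwards [cocycleRep_apply hβ π (g * h) f,
    cocycleRep_apply hβ π g (cocycleRep m p hβ π h f),
    (measurePreserving_smul g⁻¹ m).quasiMeasurePreserving.ae (cocycleRep_apply hβ π h f)]
    with x h1 h2 h3
  rw [h1, h2, h3, cocycle_inv_mul hcoc, hπ, mul_inv_rev, mul_smul]
  rfl

/-- The value at `x` of the induced defect is a defect of `(π, b)`, and `m` has mass one, so the
constant does not grow. With `K = 0`, genuine cocycles induce genuine cocycles. -/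
theorem norm_cocycle_defect_le (hβ : Measurable fun q : X × G => β q.2 q.1)
    (hfin : ∀ g, (range (β g)).Finite) (hcoc : ∀ g h x, β (g * h) x = β g (h • x) * β h x)
    {π : D → (E ≃ₗᵢ[ℝ] E)} {b : D → E} {K : ℝ}
    (hb : ∀ d e, ‖b (d * e) - b d - π d (b e)‖ ≤ K) (g h : G) :
    ‖((memLp_cocycle hβ hfin b (g * h)).toLp _ : Lp E p m) - (memLp_cocycle hβ hfin b g).toLp _ -
      cocycleRep m p hβ π g ((memLp_cocycle hβ hfin b h).toLp _)‖ ≤ K := by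
  refine Lp.norm_le_of_ae_le ((norm_nonneg _).trans (hb 1 1)) ?_
  filter_upwards [Lp.coeFn_sub (((memLp_cocycle hβ hfin b (g * h)).toLp _ : Lp E p m) -
      (memLp_cocycle hβ hfin b g).toLp _)
      (cocycleRep m p hβ π g ((memLp_cocycle hβ hfin b h).toLp _)),
    Lp.coeFn_sub ((memLp_cocycle hβ hfin b (g * h)).toLp _ : Lp E p m)
      ((memLp_cocycle hβ hfin b g).toLp _),
    (memLp_cocycle (m := m) (p := p) hβ hfin b (g * h)).coeFn_toLp,
    (memLp_cocycle (m := m) (p := p) hβ hfin b g).coeFn_toLp,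
    cocycleRep_apply hβ π g ((memLp_cocycle (m := m) (p := p) hβ hfin b h).toLp _),
    (measurePreserving_smul g⁻¹ m).quasiMeasurePreserving.ae
      (memLp_cocycle (m := m) (p := p) hβ hfin b h).coeFn_toLp] with x h1 h2 h3 h4 h5 h6
  rw [h1, Pi.sub_apply, h2, Pi.sub_apply, h3, h4, h5, h6, cocycle_inv_mul hcoc]
  exact hb _ _

/-- Each type of pair induces one of the same type. For affine actions only measurability is
immediate; continuity follows from `isAffineAction_of_measurable`. -/
theorem isPair_cocycle {X : Type} [MeasurableSpace X] [StandardBorelSpace X] [MulAction G X]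
    [MeasurableSMul₂ G X] {m : Measure X} [SMulInvariantMeasure G X m] [IsProbabilityMeasure m]
    {β : G → X → D} (hp' : p ≠ ∞) (hβ : Measurable fun q : X × G => β q.2 q.1)
    (hfin : ∀ g, (range (β g)).Finite) (hcoc : ∀ g h x, β (g * h) x = β g (h • x) * β h x)
    [TopologicalSpace D] {T : KazhdanType} {π : D → (E ≃ₗᵢ[ℝ] E)} {b : D → E}
    (hT : T.IsPair p π b) :
    T.IsPair p (cocycleRep m p hβ π)
      fun g => ((memLp_cocycle hβ hfin b g).toLp _ : Lp E p m) := by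
  have hE : IsLpSpace p E := by
    cases T with
    | F => exact IsAffineAction.isLpSpace hT
    | FF => exact (IsQuasiPair.toIsWQPair hT).isLpSpace
    | FFF => exact IsWQPair.isLpSpace hT
  have hL : IsLpSpace p (Lp E p m) := isLpSpace_Lp m hp' hE
  have := hE.secondCountableTopology hp'
  have := hL.secondCountableTopology hp'
  borelize ↥(Lp E p m)
  have hrep := measurable_cocycleRep (m := m) hp' hβ π
  have hcocycle := measurable_cocycle_toLp (m := m) hp' hβ hfin b
  have hG : borel G = ‹MeasurableSpace G› := BorelSpace.measurable_eq.symm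
  have hWQ : ∀ {K : ℝ}, (∀ d e, ‖b (d * e) - b d - π d (b e)‖ ≤ K) →
      IsWQPair p (cocycleRep m p hβ π)
        fun g => ((memLp_cocycle hβ hfin b g).toLp _ : Lp E p m) := fun {K} hK =>
    { isLpSpace := hL
      measurable_rep := by
        rw [hG]
        exact measurable_strongOperator hrep
      measurable_cocycle := by
        rw [hG]
        exact hcocycle
      bounded_defect := ⟨K, norm_cocycle_defect_le hβ hfin hcoc hK⟩ }
  cases T with
  | F =>
    have hmul := cocycleRep_mul (m := m) (p := p) hβ hcoc (IsAffineAction.map_mul hT)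
    have hb : ∀ g h, ((memLp_cocycle hβ hfin b (g * h)).toLp _ : Lp E p m) =
        (memLp_cocycle hβ hfin b g).toLp _ +
          cocycleRep m p hβ π g ((memLp_cocycle hβ hfin b h).toLp _) := fun g h => by
      have := norm_cocycle_defect_le (m := m) (p := p) hβ hfin hcoc (π := π) (b := b) (K := 0)
        (fun d e => by rw [IsAffineAction.cocycle hT d e]; simp) g h
      rwa [norm_le_zero_iff, sub_sub, sub_eq_zero] at this
    exact isAffineAction_of_measurable hL hrep hcocycle hmul hb
  | FF =>
    obtain ⟨K, hK⟩ := (IsQuasiPair.toIsWQPair hT).bounded_defect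
    exact { toIsWQPair := hWQ hK, map_mul := cocycleRep_mul hβ hcoc (IsQuasiPair.map_mul hT) }
  | FFF =>
    obtain ⟨K, hK⟩ := IsWQPair.bounded_defect hT
    exact hWQ hK

end InducedPair

/-! ### Bounded Borel sections with values in an open subgroup -/

section Section

variable {K : Type*} [Group K] [TopologicalSpace K] [IsTopologicalGroup K]
    [T2Space K] [SecondCountableTopology K] [LocallyCompactSpace K]

theorem polishSpace_of_locallyCompact_group : PolishSpace K := by
  let _ : UniformSpace K := IsTopologicalGroup.rightUniformSpace K
  have : IsRightUniformGroup K := { uniformity_eq := rfl }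
  have : CompleteSpace K := IsRightUniformGroup.completeSpace_of_weaklyLocallyCompactSpace
  have : (uniformity K).IsCountablyGenerated := Filter.comap.isCountablyGenerated _ _
  infer_instance

variable [MeasurableSpace K] [BorelSpace K] {Γ : Subgroup K}

theorem standardBorelSpace_coset (hΓ : DiscreteTopology Γ) (hc : CompactSpace (K ⧸ Γ)) :
    StandardBorelSpace (K ⧸ Γ) := by
  have := borelSpace_coset Γ hΓ
  have : IsClosed (Γ : Set K) := Subgroup.isClosed_of_discrete
  have : SecondCountableTopology (K ⧸ Γ) := inferInstance
  have : T3Space (K ⧸ Γ) := inferInstance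
  have : PolishSpace (K ⧸ Γ) := by
    let := TopologicalSpace.metrizableSpaceMetric (K ⧸ Γ)
    infer_instance
  infer_instance

/-- If `K ⧸ Γ` is compact and the open subgroup `U` meets all cosets of `Γ`, then there is a
bounded Borel section with values in `U`. -/
theorem exists_boundedBorelSection (hΓ : DiscreteTopology Γ) (hc : CompactSpace (K ⧸ Γ))
    {U : Subgroup K} (hU : IsOpen (U : Set K)) (hUΓ : ∀ k : K, ∃ γ ∈ Γ, k * γ ∈ U) :
    ∃ s : BoundedBorelSection Γ, ∀ x, s.toFun x ∈ U := by
  have := polishSpace_of_locallyCompact_group (K := K)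
  have := borelSpace_coset Γ hΓ
  have := standardBorelSpace_coset hΓ hc
  obtain ⟨O, hO, hO1⟩ : ∃ O : Set K, IsOpen O ∧ O ∩ Γ = {1} := by
    obtain ⟨O, hO, h⟩ := (isOpen_induced_iff (t := ‹TopologicalSpace K›)).1
      (isOpen_discrete ({1} : Set Γ))
    refine ⟨O, hO, ?_⟩
    ext k
    constructor
    · rintro ⟨hk, hkΓ⟩
      have : (⟨k, hkΓ⟩ : Γ) ∈ ((↑) : Γ → K) ⁻¹' O := hk
      rw [h] at this
      exact congrArg Subtype.val this
    · rintro rfl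
      have : (1 : Γ) ∈ ((↑) : Γ → K) ⁻¹' O := by rw [h]; rfl
      exact ⟨this, Γ.one_mem⟩
  obtain ⟨C, hC, hC1⟩ := exists_compact_mem_nhds (1 : K)
  -- Any translate of `V` injects into `K ⧸ Γ`, as quotients of its elements lie in `O`, which meets
  -- `Γ` only in `1`.
  obtain ⟨V, hV, hV1, hVO, hVU, hVC⟩ : ∃ V : Set K, IsOpen V ∧ 1 ∈ V ∧
      (∀ v ∈ V, ∀ w ∈ V, v⁻¹ * w ∈ O) ∧ V ⊆ U ∧ V ⊆ C := by
    have hO' : (1 : K) ∈ O := (hO1.ge rfl).1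
    have h1 : (fun q : K × K => q.1⁻¹ * q.2) ⁻¹' O ∈ nhds ((1, 1) : K × K) :=
      (hO.preimage (by fun_prop)).mem_nhds (by simpa using hO')
    rw [nhds_prod_eq, Filter.mem_prod_self_iff] at h1
    obtain ⟨V, hV, hVO⟩ := h1
    obtain ⟨V', hV', hVo, hV1⟩ := mem_nhds_iff.1
      (Filter.inter_mem (Filter.inter_mem hV (hU.mem_nhds U.one_mem)) hC1)
    exact ⟨V', hVo, hV1, fun v hv w hw => hVO (mk_mem_prod (hV' hv).1.1 (hV' hw).1.1),
      fun v hv => (hV' hv).1.2, fun v hv => (hV' hv).2⟩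
  have hrep : ∀ x : K ⧸ Γ, ∃ k ∈ U, (k : K ⧸ Γ) = x := fun x => by
    obtain ⟨k, rfl⟩ := QuotientGroup.mk_surjective x
    obtain ⟨γ, hγ, h⟩ := hUΓ k
    exact ⟨k * γ, h, QuotientGroup.mk_mul_of_mem k hγ⟩
  choose r hrU hr using hrep
  set B : (K ⧸ Γ) → Set (K ⧸ Γ) := fun x => (fun v : K => ((r x * v : K) : K ⧸ Γ)) '' V with hB
  have hBo : ∀ x, IsOpen (B x) := fun x =>
    (QuotientGroup.isOpenMap_coe.comp (isOpenMap_mul_left (r x))) V hV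
  obtain ⟨t, ht⟩ := isCompact_univ.elim_finite_subcover B hBo
    fun x _ => mem_iUnion.2 ⟨x, 1, hV1, by simp [hr]⟩
  let e := t.equivFin.symm
  let k : Fin t.card → K := fun i => r (e i)
  -- A fundamental domain: finitely many translates `k i * V` cover the quotient, and from each one
  -- keeps the points whose coset was not covered earlier.
  set F : Set K := ⋃ i, ((k i)⁻¹ * ·) ⁻¹' V ∩
    ⋂ i', ⋂ (_ : i' < i), (fun q : K => (q : K ⧸ Γ)) ⁻¹' (B (e i'))ᶜ with hF
  have hFmem : ∀ {q}, q ∈ F ↔ ∃ i, (k i)⁻¹ * q ∈ V ∧ ∀ i' < i, (q : K ⧸ Γ) ∉ B (e i') := by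
    intro q
    simp [hF]
  have hBmem : ∀ {i q}, (k i)⁻¹ * q ∈ V → (q : K ⧸ Γ) ∈ B (e i) :=
    fun {i q} h => ⟨_, h, by simp [k]⟩
  have hFm : MeasurableSet F := by
    refine MeasurableSet.iUnion fun i => ?_
    refine ((hV.preimage (continuous_const_mul _)).measurableSet).inter ?_
    exact MeasurableSet.iInter fun i' => MeasurableSet.iInter fun _ =>
      QuotientGroup.measurable_coe (hBo _).measurableSet.compl
  have hinj : InjOn (fun q : K => (q : K ⧸ Γ)) F := by
    intro q hq q' hq' h
    dsimp only at h
    obtain ⟨i, hi, hi'⟩ := hFmem.1 hq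
    obtain ⟨l, hl, hl'⟩ := hFmem.1 hq'
    obtain rfl : i = l := by
      refine le_antisymm (not_lt.1 fun hlt => ?_) (not_lt.1 fun hlt => ?_)
      · exact hi' l hlt (h ▸ hBmem hl)
      · exact hl' i hlt (h ▸ hBmem hi)
    have h1 : q⁻¹ * q' ∈ O ∩ Γ := by
      refine ⟨?_, QuotientGroup.eq.1 h⟩
      have := hVO _ hi _ hl
      simpa [mul_assoc] using this
    rw [hO1] at h1
    exact inv_mul_eq_one.1 h1
  have hsurj : ∀ x : K ⧸ Γ, ∃ q ∈ F, (q : K ⧸ Γ) = x := fun x => by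
    have hex : ∃ i, x ∈ B (e i) := by
      obtain ⟨y, hy, hxy⟩ := mem_iUnion₂.1 (ht (mem_univ x))
      exact ⟨t.equivFin ⟨y, hy⟩, by simpa [e] using hxy⟩
    obtain ⟨i, hi, hmin⟩ := WellFounded.has_min wellFounded_lt {i | x ∈ B (e i)} hex
    obtain ⟨v, hv, rfl⟩ := hi
    exact ⟨_, hFmem.2 ⟨i, by simpa [k] using hv, fun i' hi' h => hmin i' h hi'⟩, rfl⟩
  have hFU : F ⊆ U := fun q hq => by
    obtain ⟨i, hi, -⟩ := hFmem.1 hq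
    have h : k i * ((k i)⁻¹ * q) ∈ U := U.mul_mem (hrU (e i)) (hVU hi)
    rwa [mul_inv_cancel_left] at h
  have hFb : IsCompact (closure F) := by
    have hc : IsCompact (⋃ i, (k i * ·) '' C) :=
      isCompact_iUnion fun i => hC.image (continuous_const_mul _)
    refine hc.closure_of_subset fun q hq => ?_
    obtain ⟨i, hi, -⟩ := hFmem.1 hq
    exact mem_iUnion.2 ⟨i, _, hVC hi, by simp⟩
  have : StandardBorelSpace F := hFm.standardBorel
  let f : F → K ⧸ Γ := fun q => ((q : K) : K ⧸ Γ)
  -- Lusin–Souslin: an injective Borel map between standard Borel spaces has a Borel inverse, which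
  -- is the section.
  have hf : MeasurableEmbedding f :=
    (QuotientGroup.measurable_coe.comp measurable_subtype_coe).measurableEmbedding
      fun a b h => Subtype.ext (hinj a.2 b.2 h)
  have hfr : ∀ x, x ∈ range f := fun x => by
    obtain ⟨q, hq, h⟩ := hsurj x
    exact ⟨⟨q, hq⟩, h⟩
  refine ⟨{ toFun := fun x => (hf.equivRange.symm ⟨x, hfr x⟩ : F)
            measurable_toFun := ?_
            mk_toFun := fun x => ?_
            bounded := ?_ }, fun x => hFU (Subtype.coe_prop _)⟩
  · exact measurable_subtype_coe.comp
      (hf.equivRange.symm.measurable.comp (measurable_id.subtype_mk))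
  · have h := hf.equivRange.apply_symm_apply ⟨x, hfr x⟩
    rw [hf.equivRange_apply] at h
    exact congrArg Subtype.val h
  · refine hFb.of_isClosed_subset isClosed_closure (closure_mono ?_)
    rintro _ ⟨x, rfl⟩
    exact Subtype.coe_prop _

end Section

/-! ### The group generated by a model set -/

section ModelSet

variable {G H : Type*} [Group G] [Group H] {Γ : Subgroup (G × H)}

/-- For an injective projection `Γ → G`, the inverse homomorphism on a subgroup of the image. -/
noncomputable def liftFst (hinj : InjOn Prod.fst (Γ : Set (G × H))) {D : Subgroup G}
    (hD : (D : Set G) ⊆ Prod.fst '' (Γ : Set (G × H))) : D →* G × H where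
  toFun d := (hD d.2).choose
  map_one' := hinj (hD (1 : D).2).choose_spec.1 Γ.one_mem (hD (1 : D).2).choose_spec.2
  map_mul' d e := hinj (hD (d * e).2).choose_spec.1
    (Γ.mul_mem (hD d.2).choose_spec.1 (hD e.2).choose_spec.1)
    ((hD (d * e).2).choose_spec.2.trans
      (congrArg₂ (· * ·) (hD d.2).choose_spec.2 (hD e.2).choose_spec.2).symm)

variable (hinj : InjOn Prod.fst (Γ : Set (G × H))) {D : Subgroup G}
    (hD : (D : Set G) ⊆ Prod.fst '' (Γ : Set (G × H)))

theorem liftFst_mem (d : D) : liftFst hinj hD d ∈ Γ := (hD d.2).choose_spec.1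

theorem fst_liftFst (d : D) : (liftFst hinj hD d).1 = d := (hD d.2).choose_spec.2

theorem liftFst_injective : Function.Injective (liftFst hinj hD) := fun d e h =>
  Subtype.ext (by rw [← fst_liftFst hinj hD d, h, fst_liftFst])

theorem liftFst_eq {γ : G × H} (hγ : γ ∈ Γ) (h : γ.1 ∈ D) : liftFst hinj hD ⟨γ.1, h⟩ = γ :=
  hinj (liftFst_mem hinj hD _) hγ (fst_liftFst hinj hD _)

theorem closure_modelSet_subset (W : Set H) :
    (Subgroup.closure (modelSet Γ W) : Set G) ⊆ Prod.fst '' (Γ : Set (G × H)) := by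
  have : Subgroup.closure (modelSet Γ W) ≤ Γ.map (MonoidHom.fst G H) := by
    rw [Subgroup.closure_le]
    rintro _ ⟨γ, ⟨hγ, -⟩, rfl⟩
    exact ⟨γ, hγ, rfl⟩
  exact this

theorem fst_mem_closure_modelSet {W : Set H} {γ : G × H} (hγ : γ ∈ Γ) (h : γ.2 ∈ W) :
    γ.1 ∈ Subgroup.closure (modelSet Γ W) :=
  Subgroup.subset_closure ⟨γ, ⟨hγ, mem_univ _, h⟩, rfl⟩

variable [TopologicalSpace G] [TopologicalSpace H] [IsTopologicalGroup H]

/-- The group generated by a model set whose window has non-empty interior consists of the elements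
of `Γ` over an open subgroup. -/
theorem exists_isOpen_subgroup_closure_modelSet (hd : Dense (Prod.snd '' (Γ : Set (G × H))))
    {W : Set H} (hW : (interior W).Nonempty) :
    ∃ U : Subgroup H, IsOpen (U : Set H) ∧
      ∀ γ ∈ Γ, γ.2 ∈ U → γ.1 ∈ Subgroup.closure (modelSet Γ W) := by
  set D := Subgroup.closure (modelSet Γ W)
  -- The open subgroup is the closure of `L`. Multiplying by `γ₀⁻¹` moves `interior W` to a
  -- neighbourhood `O` of `1` over which all elements of `Γ` project into `D`; by density, the
  -- closure of `L` contains `O`.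
  let L : Subgroup H := (Γ ⊓ D.comap (MonoidHom.fst G H)).map (MonoidHom.snd G H)
  obtain ⟨_, ⟨γ₀, hγ₀, rfl⟩, hγ₀W⟩ := hd.exists_mem_open isOpen_interior hW
  have hO : IsOpen ((γ₀.2 * ·) ⁻¹' interior W) := isOpen_interior.preimage (continuous_const_mul _)
  have hO1 : (1 : H) ∈ (γ₀.2 * ·) ⁻¹' interior W := by simpa using hγ₀W
  have hOD : ∀ γ ∈ Γ, γ.2 ∈ (γ₀.2 * ·) ⁻¹' interior W → γ.1 ∈ D := fun γ hγ h => by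
    have h1 : (γ₀ * γ).1 ∈ D :=
      fst_mem_closure_modelSet (Γ.mul_mem hγ₀ hγ) (interior_subset h)
    exact (D.mul_mem_cancel_left (fst_mem_closure_modelSet hγ₀ (interior_subset hγ₀W))).1 h1
  set O := (γ₀.2 * ·) ⁻¹' interior W
  refine ⟨L.topologicalClosure, Subgroup.isOpen_of_mem_nhds _ (g := 1)
    (Filter.mem_of_superset (hO.mem_nhds hO1) ?_), fun γ hγ h => ?_⟩
  · refine (hd.open_subset_closure_inter hO).trans (closure_mono ?_)
    rintro _ ⟨hγO, γ, hγ, rfl⟩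
    exact ⟨γ, ⟨hγ, hOD γ hγ hγO⟩, rfl⟩
  · have hn : (fun h : H => h⁻¹ * γ.2) ⁻¹' O ∈ nhds γ.2 :=
      (hO.preimage (by fun_prop)).mem_nhds (by simpa using hO1)
    obtain ⟨_, hδO, δ, ⟨hδ, hδD⟩, rfl⟩ := mem_closure_iff_nhds.1 h _ hn
    have h1 : (δ⁻¹ * γ).1 ∈ D := hOD _ (Γ.mul_mem (Γ.inv_mem hδ) hγ) hδO
    exact (D.mul_mem_cancel_left (D.inv_mem hδD)).1 h1

end ModelSet

/-! ### Part (2) and the theorem -/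

section Main

variable {G H : Type*}
    [Group G] [TopologicalSpace G] [IsTopologicalGroup G] [T2Space G] [LocallyCompactSpace G]
    [SecondCountableTopology G] [MeasurableSpace G] [BorelSpace G]
    [Group H] [TopologicalSpace H] [IsTopologicalGroup H] [T2Space H] [LocallyCompactSpace H]
    [SecondCountableTopology H] [MeasurableSpace H] [BorelSpace H]

theorem hasRel_of_cocycle {X : Type} [MeasurableSpace X] [StandardBorelSpace X] [MulAction G X]
    [MeasurableSMul₂ G X] (m : Measure X) [IsProbabilityMeasure m] [SMulInvariantMeasure G X m]
    {D : Type*} [Group D] [TopologicalSpace D] [Countable D] {j : D →* G × H}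
    {s : X → G × H} {β : G → X → D}
    (μ : Measure G) [μ.IsHaarMeasure] [μ.IsMulRightInvariant]
    (hj : Function.Injective j) (hfin : ∀ P : Set (G × H), IsCompact P → {d | j d ∈ P}.Finite)
    (hs : Measurable s) {P : Set (G × H)} (hP : IsCompact P) (hsP : ∀ x, s x ∈ P)
    (hβ : ∀ g x, s (g • x) * j (β g x) = (g, 1) * s x)
    {W : Set H} (hW : IsCompact W) {p : ℝ≥0∞} [hp : Fact (1 ≤ p)] (hp' : p ≠ ∞)
    {T : KazhdanType} (hT : T.Has p G) : T.HasRel p D {d | (j d).2 ∈ W} := by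
  intro E _ _ π b hπb
  let : MeasurableSpace D := ⊤
  have : DiscreteMeasurableSpace D := ⟨fun _ => trivial⟩
  have hβm : Measurable fun q : X × G => β q.2 q.1 :=
    fun A _ => measurableSet_cocycle_mem hj hs hβ A
  have hcoc : ∀ g h x, β (g * h) x = β g (h • x) * β h x := cocycle_mul hj hβ
  have hβfin : ∀ g, (range (β g)).Finite := fun g => by
    refine (hfin _ ((hP.prod hP).image
      (f := fun q : (G × H) × (G × H) => q.1⁻¹ * ((g, 1) * q.2)) (by fun_prop))).subset ?_
    rintro _ ⟨x, rfl⟩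
    exact ⟨(s (g • x), s x), ⟨hsP _, hsP _⟩, by simp [← hβ]⟩
  obtain ⟨C, hC⟩ := hT _ _ _ (isPair_cocycle (m := m) hp' hβm hβfin hcoc hπb)
  obtain ⟨K, hK⟩ : ∃ K, ∀ d e, ‖b (d * e) - b d - π d (b e)‖ ≤ K := by
    cases T with
    | F => exact ⟨0, fun d e => by rw [IsAffineAction.cocycle hπb d e]; simp⟩
    | FF => exact (IsQuasiPair.toIsWQPair hπb).bounded_defect
    | FFF => exact IsWQPair.bounded_defect hπb
  have hmem := fun g => memLp_cocycle (m := m) (p := p) hβm hβfin b g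
  refine isBoundedOn_of_eLpNorm_le (m := m) μ hj hfin hs hP hsP hβ hW hK hp.out hp'
    (C := ENNReal.ofReal C) (by finiteness) (fun g => (hmem g).1) (fun g => ?_)
  have h := hC g (mem_univ _)
  have hC0 : 0 ≤ C := (norm_nonneg _).trans h
  rw [Lp.norm_toLp] at h
  exact (ENNReal.le_ofReal_iff_toReal_le (hmem g).2.ne hC0).2 h

theorem hasApprox_modelSet {Γ : Subgroup (G × H)} (hΓ : IsUniformCutAndProjectScheme Γ)
    {W : Set H} (hW : IsCompact W) (hWi : (interior W).Nonempty)
    {p : ℝ≥0∞} [Fact (1 ≤ p)] (hp' : p ≠ ∞) {T : KazhdanType} (hT : T.Has p G) :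
    T.HasApprox p (modelSet Γ W) := by
  have hdisc := hΓ.discrete
  have hcomp := hΓ.compact
  obtain ⟨m, _, _⟩ := hΓ.exists_measure
  obtain ⟨U, hU, hUD⟩ := exists_isOpen_subgroup_closure_modelSet hΓ.dense_snd hWi
  -- Elements of `G × {1}` act trivially on the `H`-coordinate, so a section valued in `G × U` keeps
  -- `β (g, 1) x` over `U`, hence its `G`-coordinate in `Λ^∞`. Density of `Γ` in `H` ensures that
  -- the open subgroup `G × U` meets every coset.
  obtain ⟨s, hs⟩ := exists_boundedBorelSection hdisc hcomp
    (U := (⊤ : Subgroup G).prod U) (by rw [Subgroup.coe_prod, Subgroup.coe_top]; exact isOpen_univ.prod hU) fun k => by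
      obtain ⟨_, ⟨γ, hγ, rfl⟩, hγU⟩ := hΓ.dense_snd.exists_mem_open
        (hU.preimage (continuous_const_mul k.2)) ⟨k.2⁻¹, by simp⟩
      exact ⟨γ, hγ, Subgroup.mem_prod.2 ⟨trivial, hγU⟩⟩
  have hsU : ∀ x, (s.toFun x).2 ∈ U := fun x => (Subgroup.mem_prod.1 (hs x)).2
  have := isMulRightInvariant_of_lattice_prod hdisc s m (Measure.haar : Measure G)
  have := standardBorelSpace_coset hdisc hcomp
  have : Countable Γ := countable_of_Lindelof_of_discrete
  let := fstAction Γ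
  have := measurableSMul₂_fstAction hdisc
  have := smulInvariantMeasure_fstAction m
  -- The coset space is replaced by a Borel copy in `ℝ`, so that `L^p` over it lies in `Type`, as
  -- the definitions of `IsLpSpace` and `KazhdanType.HasRel` require.
  obtain ⟨f, hf⟩ := exists_measurableEmbedding_real ((G × H) ⧸ Γ)
  let φ := hf.equivRange
  have : StandardBorelSpace (range f) := hf.measurableSet_range.standardBorel
  let : MulAction G (range f) := φ.symm.toEquiv.mulAction G
  have hsmul : ∀ (g : G) (x : range f), g • x = φ (g • φ.symm x) := fun g x => rfl
  have : MeasurableSMul₂ G (range f) := by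
    constructor
    simp only [hsmul]
    fun_prop
  have : IsProbabilityMeasure (m.map φ) := Measure.isProbabilityMeasure_map φ.measurable.aemeasurable
  have : SMulInvariantMeasure G (range f) (m.map φ) := by
    refine ⟨fun g A hA => ?_⟩
    rw [Measure.map_apply φ.measurable hA, Measure.map_apply φ.measurable
      ((measurable_const_smul g) hA), ← measure_preimage_smul m g (φ ⁻¹' A)]
    congr 1
    ext x
    simp [hsmul]
  set D := Subgroup.closure (modelSet Γ W)
  have hD : (D : Set G) ⊆ Prod.fst '' (Γ : Set (G × H)) := closure_modelSet_subset W
  set j := liftFst hΓ.injOn_fst hD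
  have hjinj : Function.Injective j := liftFst_injective _ _
  let jΓ : D → Γ := fun d => ⟨j d, liftFst_mem _ _ d⟩
  have hjΓ : Function.Injective jΓ := fun d e h => hjinj (congrArg Subtype.val h)
  have : Countable D := hjΓ.countable
  have hfin : ∀ P : Set (G × H), IsCompact P → {d | j d ∈ P}.Finite := fun P hP =>
    (finite_mem_of_isCompact hdisc hP).preimage (f := jΓ) hjΓ.injOn
  have hβD : ∀ (g : G) (x : (G × H) ⧸ Γ), (s.beta (g, 1) x : G × H).1 ∈ D := fun g x =>
    hUD _ (s.beta (g, 1) x).2 (U.mul_mem (U.inv_mem (hsU _)) (U.mul_mem U.one_mem (hsU _)))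
  let : TopologicalSpace D := ⊥
  have key := hasRel_of_cocycle (m.map φ) (j := j) (s := fun x => s.toFun (φ.symm x))
    (β := fun g x => ⟨(s.beta (g, 1) (φ.symm x) : G × H).1, hβD g _⟩)
    (Measure.haar : Measure G) hjinj hfin (s.measurable_toFun.comp φ.symm.measurable) s.bounded
    (fun x => subset_closure (mem_range_self _))
    (fun g x => by
      rw [liftFst_eq _ _ (s.beta (g, 1) (φ.symm x)).2, hsmul, φ.symm_apply_apply]
      exact s.mul_beta (g, 1) (φ.symm x)) hW hp' hT
  intro E _ _ π b hπb
  obtain ⟨C, hC⟩ := key E π b hπb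
  refine ⟨C, ?_⟩
  rintro ⟨_, hd⟩ ⟨γ, ⟨hγ, -, hγW⟩, rfl⟩
  refine hC _ ?_
  rw [mem_ofPred_eq, liftFst_eq _ _ hγ]
  exact hγW

end Main

theorem theorem5p6 {G H : Type*}
    [Group G] [TopologicalSpace G] [IsTopologicalGroup G] [T2Space G] [LocallyCompactSpace G]
    [SecondCountableTopology G] [MeasurableSpace G] [BorelSpace G]
    [Group H] [TopologicalSpace H] [IsTopologicalGroup H] [T2Space H] [LocallyCompactSpace H]
    [SecondCountableTopology H] [MeasurableSpace H] [BorelSpace H]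
    (Γ : Subgroup (G × H)) (hΓ : IsUniformCutAndProjectScheme Γ)
    (W : Set H) (hW : IsCompact W)
    (p : ℝ≥0∞) [Fact (1 ≤ p)] (hp : 1 < p) (hp' : p < ∞) :
    (∀ {E : Type*} [NormedAddCommGroup E] [NormedSpace ℝ E]
        (π : Γ → (E ≃ₗᵢ[ℝ] E)) (b : Γ → E), IsWQPair p π b →
      ∀ (m : Measure ((G × H) ⧸ Γ)) [IsProbabilityMeasure m]
        [SMulInvariantMeasure (G × H) ((G × H) ⧸ Γ) m] (s : BoundedBorelSection Γ),
        IsBoundedOn (inducedPair hΓ.discrete s m p (π, b)).2 (univ ×ˢ {1}) →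
        IsBoundedOn b (windowSet Γ W)) ∧
    ((interior W).Nonempty → (∀ x ∈ modelSet Γ W, x⁻¹ ∈ modelSet Γ W) → 1 ∈ modelSet Γ W →
      ∀ T : KazhdanType, T.Has p G → T.HasApprox p (modelSet Γ W)) := by
  refine ⟨fun π b hb m _ _ s h => isBoundedOn_windowSet hΓ.discrete hW hp' hb m s h,
    fun hWi _ _ T hT => hasApprox_modelSet hΓ hW hWi hp'.ne hT⟩
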